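/- Let $c,d,k_0,d_0\ge 1$ be integers and $\alpha,\delta\in(0,1]$ real numbers with $\delta d_0>3$, and let $C_0\subseteq\mathbb F_2^d$ be a $[d,k_0,d_0]$-linear code, i.e. a linear subspace of dimension $k_0$ and minimum Hamming distance $d_0$. A $(c,d,\alpha,\delta)$-bipartite expander is a bipartite graph $G$ with parts $L=\{1,\dots,n\}$, $n\ge 1$, and $R$, in which every $v\in L$ has exactly $c$ neighbours, every $u\in R$ has exactly $d$ neighbours, and every $S\subseteq L$ with $|S|\le\alpha n$ has at least $\delta c|S|$ neighbours in $R$. Its Tanner code is $$T(G,C_0)=\{x\in\mathbb F_2^n:\ x_{N(u)}\in C_0\text{ for every }u\in R\},$$ where $x_{N(u)}\in\mathbb F_2^d$ is the restriction of $x$ to the neighbourhood $N(u)$ of $u$, its coordinates being read in the order in which the adjacency list of $u$ enumerates $N(u)$ (any order, for instance the increasing one). Then $T(G,C_0)$ has a deterministic linear-time decoding algorithm that corrects $\gamma n$ errors, where $$\gamma=\frac{2\alpha}{d_0(1+0.5\,c\,\delta)}.$$ That is, there are a deterministic random access machine program (with unit-cost operations: constants, indirect reading and writing of finitely many arrays of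 natural numbers, adding or subtracting one, comparisons) and a constant $K$, both depending only on $c,d,\alpha,\delta,C_0$, such that for every $n\ge1$, every $(c,d,\alpha,\delta)$-bipartite expander $G$ with $|L|=n$, given by the adjacency lists of all its vertices, and every $x\in\mathbb F_2^n$, the program on input $(G,x)$ halts after at most $Kn$ steps, and if some $y\in T(G,C_0)$ satisfies $d_H(x,y)\le\gamma n$, where $d_H$ is the Hamming distance, then its output is $y$. -/

import Mathlib

namespace ExpanderCode

/-! ### Codes, bipartite expanders, Tanner codes -/

/-- `C` is a binary `[d, k₀, d₀]`-linear code: a `k₀`-dimensional subspace of `𝔽₂^d` whose minimum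
distance (the least Hamming distance of two distinct codewords) is `d₀`. -/
structure IsLinearCode {d : ℕ} (C : Submodule (ZMod 2) (Fin d → ZMod 2)) (k₀ d₀ : ℕ) : Prop where
  dim : Module.finrank (ZMod 2) C = k₀
  minDist : IsLeast {m : ℕ | ∃ x ∈ C, ∃ y ∈ C, x ≠ y ∧ hammingDist x y = m} d₀

/-- `G` is a `(c, d, α, δ)`-bipartite expander with parts `L = Fin n` (the variables) and
`R = Fin r` (the constraints): it is bipartite and `(c, d)`-regular, and every `S ⊆ L` with
`|S| ≤ α n` has at least `δ c |S|` neighbours in `R`. -/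
structure IsBipartiteExpander {n r : ℕ} (G : SimpleGraph (Fin n ⊕ Fin r)) (c d : ℕ) (α δ : ℝ) :
    Prop where
  bipartite : G ≤ completeBipartiteGraph (Fin n) (Fin r)
  left_regular : ∀ v : Fin n, (G.neighborSet (Sum.inl v)).ncard = c
  right_regular : ∀ u : Fin r, (G.neighborSet (Sum.inr u)).ncard = d
  expansion : ∀ S : Finset (Fin n), (S.card : ℝ) ≤ α * n →
    δ * c * S.card ≤ (({u : Fin r | ∃ v ∈ S, G.Adj (Sum.inl v) (Sum.inr u)}.ncard : ℕ) : ℝ)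

/-- Adjacency lists of a `(c, d)`-regular bipartite graph `G`: `right u` lists the `d` neighbours
of the constraint `u` without repetition, and `left v` the `c` neighbours of the variable `v`.
The order inside a list is arbitrary (the increasing order is one possible choice). -/
structure AdjacencyLists {n r : ℕ} (G : SimpleGraph (Fin n ⊕ Fin r)) (c d : ℕ) where
  right : Fin r → Fin d → Fin n
  left : Fin n → Fin c → Fin r
  right_injective : ∀ u, Function.Injective (right u)
  range_right : ∀ u, Set.range (right u) = {v | G.Adj (Sum.inr u) (Sum.inl v)}
  left_injective : ∀ v, Function.Injective (left v)
  range_left : ∀ v, Set.range (left v) = {u | G.Adj (Sum.inl v) (Sum.inr u)}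

/-- The Tanner code `T(G, C₀)`: all `x ∈ 𝔽₂^n` such that for every constraint `u` the restriction
`x_{N(u)}`, read in the order in which the neighbours of `u` are listed, is a codeword of `C₀`. -/
def tannerCode {n r c d : ℕ} {G : SimpleGraph (Fin n ⊕ Fin r)} (A : AdjacencyLists G c d)
    (C₀ : Submodule (ZMod 2) (Fin d → ZMod 2)) : Set (Fin n → ZMod 2) :=
  {x | ∀ u : Fin r, (fun j => x (A.right u j)) ∈ C₀}

/-! ### The machine model

A deterministic random access machine whose only arithmetic is adding or subtracting one, with
structured control flow. The memory consists of arrays of natural numbers; a program names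
finitely many arrays, and any cell of these can be reached in one step through a computed index.
A value can exceed the largest number in the input and in the program text by at most the number
of steps made, so in a computation of linearly many steps every cell holds `O(log n)` bits, and
charging one unit for each operation is realistic. -/

/-- The arrays: `size`, `word`, `right j` and `left i` carry the input, and `word` the output;
the arrays `work k` are scratch space. -/
inductive ArrayName : Type
  | size
  | word
  | right (j : ℕ)
  | left (i : ℕ)
  | work (k : ℕ)
  deriving DecidableEq

/-- A memory state: the content of each cell of each array. -/
abbrev Memory : Type := ArrayName → ℕ → ℕ

/-- Expressions: constants, the content of a cell of a named array, successor and predecessor. -/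
inductive Expr : Type
  | const (k : ℕ)
  | read (a : ArrayName) (i : Expr)
  | succ (e : Expr)
  | pred (e : Expr)

/-- The value of an expression (the predecessor of `0` is `0`). -/
def Expr.value (s : Memory) : Expr → ℕ
  | .const k => k
  | .read a i => s a (i.value s)
  | .succ e => e.value s + 1
  | .pred e => e.value s - 1

/-- The number of steps needed to evaluate an expression: one for each constant, memory access,
successor and predecessor in it. -/
def Expr.cost : Expr → ℕ
  | .const _ => 1
  | .read _ i => i.cost + 1
  | .succ e => e.cost + 1
  | .pred e => e.cost + 1

/-- Programs. `write a i e` stores the value of `e` in cell `i` of the array `a`;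
`ifLe e f p q` runs `p` if `e ≤ f` and `q` otherwise; `whileLe e f p` repeats `p` as long as
`e ≤ f`. -/
inductive Prog : Type
  | skip
  | write (a : ArrayName) (i e : Expr)
  | seq (p q : Prog)
  | ifLe (e f : Expr) (p q : Prog)
  | whileLe (e f : Expr) (p : Prog)

/-- The memory after storing `v` in cell `i` of the array `a`. -/
def Memory.set (s : Memory) (a : ArrayName) (i v : ℕ) : Memory :=
  Function.update s a (Function.update (s a) i v)

/-- `Runs p s t s'`: started in memory state `s`, the program `p` halts in memory state `s'`
after exactly `t` steps. Every evaluation of an expression is charged its cost, and every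
instruction and every test one further step. -/
inductive Runs : Prog → Memory → ℕ → Memory → Prop
  | skip (s : Memory) : Runs .skip s 1 s
  | write (s : Memory) (a : ArrayName) (i e : Expr) :
      Runs (.write a i e) s (i.cost + e.cost + 1) (s.set a (i.value s) (e.value s))
  | seq {p q : Prog} {s s' s'' : Memory} {t t' : ℕ} :
      Runs p s t s' → Runs q s' t' s'' → Runs (.seq p q) s (t + t') s''
  | ifLe_pos {e f : Expr} {p q : Prog} {s s' : Memory} {t : ℕ} :
      e.value s ≤ f.value s → Runs p s t s' →
      Runs (.ifLe e f p q) s (e.cost + f.cost + 1 + t) s'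
  | ifLe_neg {e f : Expr} {p q : Prog} {s s' : Memory} {t : ℕ} :
      ¬ e.value s ≤ f.value s → Runs q s t s' →
      Runs (.ifLe e f p q) s (e.cost + f.cost + 1 + t) s'
  | while_done {e f : Expr} {p : Prog} {s : Memory} :
      ¬ e.value s ≤ f.value s → Runs (.whileLe e f p) s (e.cost + f.cost + 1) s
  | while_step {e f : Expr} {p : Prog} {s s' s'' : Memory} {t t' : ℕ} :
      e.value s ≤ f.value s → Runs p s t s' → Runs (.whileLe e f p) s' t' s'' →
      Runs (.whileLe e f p) s (e.cost + f.cost + 1 + t + t') s''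

/-- The model is deterministic: the running time and the final memory are determined by the
program and the initial memory. -/
theorem Runs.deterministic {p : Prog} {s s₁ s₂ : Memory} {t₁ t₂ : ℕ}
    (h₁ : Runs p s t₁ s₁) (h₂ : Runs p s t₂ s₂) : t₁ = t₂ ∧ s₁ = s₂ := by
  induction h₁ generalizing t₂ s₂ with
  | skip s => cases h₂; exact ⟨rfl, rfl⟩
  | write s a i e => cases h₂; exact ⟨rfl, rfl⟩
  | seq _ _ ih ih' =>
    cases h₂ with
    | seq g g' =>
      obtain ⟨rfl, rfl⟩ := ih g
      obtain ⟨rfl, rfl⟩ := ih' g'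
      exact ⟨rfl, rfl⟩
  | ifLe_pos h _ ih =>
    cases h₂ with
    | ifLe_pos _ g => obtain ⟨rfl, rfl⟩ := ih g; exact ⟨rfl, rfl⟩
    | ifLe_neg h' _ => exact absurd h h'
  | ifLe_neg h _ ih =>
    cases h₂ with
    | ifLe_pos h' _ => exact absurd h' h
    | ifLe_neg _ g => obtain ⟨rfl, rfl⟩ := ih g; exact ⟨rfl, rfl⟩
  | while_done h =>
    cases h₂ with
    | while_done _ => exact ⟨rfl, rfl⟩
    | while_step h' _ _ => exact absurd h' h
  | while_step h _ _ ih ih' =>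
    cases h₂ with
    | while_done h' => exact absurd h h'
    | while_step _ g g' =>
      obtain ⟨rfl, rfl⟩ := ih g
      obtain ⟨rfl, rfl⟩ := ih' g'
      exact ⟨rfl, rfl⟩

/-- The initial memory for a graph given by adjacency lists `A` and a received word `x`: the
numbers `n` and `r` of variables and constraints are in cells `0` and `1` of `size`, the bit `x_v`
is in cell `v` of `word`, the `j`-th neighbour of the constraint `u` is in cell `u` of `right j`,
the `i`-th neighbour of the variable `v` is in cell `v` of `left i`, and all other cells
contain `0`. -/
def inputMemory {n r c d : ℕ} {G : SimpleGraph (Fin n ⊕ Fin r)} (A : AdjacencyLists G c d)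
    (x : Fin n → ZMod 2) : Memory
  | .size, k => if k = 0 then n else if k = 1 then r else 0
  | .word, v => if h : v < n then (x ⟨v, h⟩).val else 0
  | .right j, u => if h : u < r ∧ j < d then (A.right ⟨u, h.1⟩ ⟨j, h.2⟩ : ℕ) else 0
  | .left i, v => if h : v < n ∧ i < c then (A.left ⟨v, h.1⟩ ⟨i, h.2⟩ : ℕ) else 0
  | .work _, _ => 0

end ExpanderCode

namespace ExpanderCode

open Finset

/-! ### Votes of violated constraints, and the effect of one flipping step on the errors. -/

section Combinatorics

variable {n r c d : ℕ} {G : SimpleGraph (Fin n ⊕ Fin r)} (A : AdjacencyLists G c d)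
  (C₀ : Submodule (ZMod 2) (Fin d → ZMod 2))

/-! Fix a codeword `y` and a word `x`. Let `F` be the set of errors, `U` the set of violated
constraints, and `f(u)` the number of errors seen by the constraint `u`, so that `∑ f(u) = c|F|`. If
`|F| ≤ αn`, expansion gives at least `δc|F|` constraints with `f(u) ≥ 1`.

Progress. Choose `t` with `3t + 1 ≤ d₀ ≤ 3t + 3`. A violated constraint whose view is within `t` of
a codeword of `C₀` votes for one position in which the two differ. If `1 ≤ f(u) ≤ t`, the vote goes
to an error; a vote for a correct variable needs `f(u) ≥ d₀ - t`. Let `a` and `b` count these two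
kinds of constraints. Weighing constraints by `f(u)` gives `t(a - b) ≥ ((t + 1)δ - 1)c|F|`, and `(t
+ 1)δ > 1` because `δd₀ > 3`. For each `q`, consider the errors removed minus those created by
flipping all variables with at least `q` votes. Over `q = 1, …, c` these gains add up to the votes
for errors minus the votes for correct variables, hence to at least `a - b`. So some `q` removes a
fixed fraction of the errors (`exists_flipStep_progress`).

Search. The decoder does not know this `q`, but it sees `|U|`, and `(δd₀ - 1)c|F| ≤ (d₀ - 1)|U| ≤
(d₀ - 1)c|F|` as long as `|F| ≤ αn` (`card_errors_le_card_unsat`, `card_unsat_le`). It therefore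
tries all `c^s` lists of `s` thresholds, for a constant `s`, and keeps the first that divides `|U|`
by `B`. The danger is that bad thresholds lead beyond `αn` errors, where a small `|U|` proves
nothing. One step multiplies `|F|` by at most `1 + c/(d₀ - t)` (`card_errors_flipStep_le`), and the
value of `γ` makes `(1 + c/(d₀ - t))γ ≤ α`. After that step `|U|` is still meaningful, and the test
`B|U| ≤ an` (from here on `a` is the threshold parameter) certifies that `|F|` is small enough for
one more arbitrary step (`card_errors_flipSteps_le`). Hence every accepted list keeps the word
within radius `γn` (`card_errors_le_of_accepts`), even if it is not the list of good thresholds,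
while that list always passes (`exists_accepts`).

Time. The violated constraints are kept in an indexed list. Votes are counted and cleared by walking
along it, and flipped variables go on a stack so that a failed attempt can be undone; an attempt
thus costs `O(|U| + 1)`. Accepted rounds at least halve `|U|` and a rejected round ends the
computation, so the costs form a geometric series bounded by `O(n)` on every input
(`mainProg_term`). -/

theorem AdjacencyLists.exists_right_iff (u : Fin r) (v : Fin n) :
    (∃ j, A.right u j = v) ↔ G.Adj (Sum.inl v) (Sum.inr u) := by
  have h := Set.ext_iff.1 (A.range_right u) v
  simp only [Set.mem_range, Set.mem_ofPred_eq] at h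
  rw [h, G.adj_comm]

theorem AdjacencyLists.exists_left_iff (u : Fin r) (v : Fin n) :
    (∃ i, A.left v i = u) ↔ G.Adj (Sum.inl v) (Sum.inr u) := by
  have h := Set.ext_iff.1 (A.range_left v) u
  simpa only [Set.mem_range, Set.mem_ofPred_eq] using h

theorem AdjacencyLists.exists_left_iff_exists_right (u : Fin r) (v : Fin n) :
    (∃ i, A.left v i = u) ↔ ∃ j, A.right u j = v := by
  rw [A.exists_left_iff, A.exists_right_iff]

/-- The restriction of a word to the neighbourhood of a constraint. -/
def view (x : Fin n → ZMod 2) (u : Fin r) : Fin d → ZMod 2 := fun j => x (A.right u j)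

open Classical in
/-- The constraints violated by a word. -/
noncomputable def unsat (x : Fin n → ZMod 2) : Finset (Fin r) :=
  univ.filter fun u => view A x u ∉ C₀

theorem mem_unsat {x : Fin n → ZMod 2} {u : Fin r} : u ∈ unsat A C₀ x ↔ view A x u ∉ C₀ := by
  simp [unsat]

open Classical in
/-- A position in which a local word differs from a codeword at distance at most `t`, if any. -/
noncomputable def message (t : ℕ) (w : Fin d → ZMod 2) : Option (Fin d) :=
  if h : ∃ j, ∃ z ∈ C₀, hammingDist w z ≤ t ∧ w j ≠ z j then some h.choose else none

theorem message_eq_some {t : ℕ} {w : Fin d → ZMod 2} {j : Fin d} (h : message C₀ t w = some j) :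
    ∃ z ∈ C₀, hammingDist w z ≤ t ∧ w j ≠ z j := by
  unfold message at h
  split_ifs at h with h'
  obtain rfl := Option.some.inj h
  exact h'.choose_spec

theorem exists_message {t : ℕ} {w z : Fin d → ZMod 2} (hz : z ∈ C₀) (h : hammingDist w z ≤ t)
    (hne : w ≠ z) : ∃ j, message C₀ t w = some j := by
  obtain ⟨j, hj⟩ := Function.ne_iff.1 hne
  have h' : ∃ j, ∃ z ∈ C₀, hammingDist w z ≤ t ∧ w j ≠ z j := ⟨j, z, hz, h, hj⟩
  exact ⟨h'.choose, by unfold message; rw [dif_pos h']⟩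

/-- The variable for which a constraint votes. -/
noncomputable def target (t : ℕ) (x : Fin n → ZMod 2) (u : Fin r) : Option (Fin n) :=
  (message C₀ t (view A x u)).map (A.right u)

/-- The number of votes that a variable receives from violated constraints. -/
noncomputable def votes (t : ℕ) (x : Fin n → ZMod 2) (v : Fin n) : ℕ :=
  ((unsat A C₀ x).filter fun u => target A C₀ t x u = some v).card

/-- Flip all variables that receive at least `q` votes. -/
noncomputable def flipStep (t q : ℕ) (x : Fin n → ZMod 2) : Fin n → ZMod 2 :=
  fun v => if q ≤ votes A C₀ t x v then x v + 1 else x v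

/-- The positions in which two words differ. -/
def errors (x y : Fin n → ZMod 2) : Finset (Fin n) := univ.filter fun v => x v ≠ y v

theorem mem_errors {x y : Fin n → ZMod 2} {v : Fin n} : v ∈ errors x y ↔ x v ≠ y v := by
  simp [errors]

theorem card_errors (x y : Fin n → ZMod 2) : (errors x y).card = hammingDist x y := rfl

theorem target_eq_some {t : ℕ} {x : Fin n → ZMod 2} {u : Fin r} {v : Fin n}
    (h : target A C₀ t x u = some v) :
    ∃ j, A.right u j = v ∧ ∃ z ∈ C₀, hammingDist (view A x u) z ≤ t ∧ x v ≠ z j := by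
  obtain ⟨j, hj, rfl⟩ := Option.map_eq_some_iff.1 h
  exact ⟨j, rfl, message_eq_some C₀ hj⟩

/-- Double counting of the edges between `S` and the constraints. -/
theorem sum_card_right (S : Finset (Fin n)) :
    ∑ u : Fin r, (univ.filter fun j => A.right u j ∈ S).card = c * S.card := by
  classical
  have h1 : ∀ u : Fin r, (univ.filter fun j => A.right u j ∈ S).card =
      (S.filter fun v => ∃ j, A.right u j = v).card := by
    intro u
    rw [← card_image_of_injective _ (A.right_injective u)]
    congr 1
    ext v
    simp only [mem_image, mem_filter, mem_univ, true_and]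
    constructor
    · rintro ⟨j, hj, rfl⟩; exact ⟨hj, j, rfl⟩
    · rintro ⟨hj, j, rfl⟩; exact ⟨j, hj, rfl⟩
  have h2 : ∀ v : Fin n, (univ.filter fun u : Fin r => ∃ j, A.right u j = v).card = c := by
    intro v
    have : (univ.filter fun u : Fin r => ∃ j, A.right u j = v) = univ.image (A.left v) := by
      ext u
      simp [← A.exists_left_iff_exists_right]
    rw [this, card_image_of_injective _ (A.left_injective v), card_univ, Fintype.card_fin]
  simp_rw [h1, card_filter]
  rw [sum_comm]
  simp_rw [← card_filter, h2]
  simp [mul_comm]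

theorem card_constraints (A : AdjacencyLists G c d) : r * d = c * n := by
  simpa using sum_card_right A univ

theorem hammingDist_view (x y : Fin n → ZMod 2) (u : Fin r) :
    hammingDist (view A x u) (view A y u) =
      (univ.filter fun j => A.right u j ∈ errors x y).card := by
  simp only [hammingDist, view, mem_errors]
  congr!

theorem sum_hammingDist_view (x y : Fin n → ZMod 2) :
    ∑ u : Fin r, hammingDist (view A x u) (view A y u) = c * (errors x y).card := by
  simp_rw [hammingDist_view, sum_card_right]

theorem one_le_hammingDist_view (x y : Fin n → ZMod 2) (u : Fin r) :
    1 ≤ hammingDist (view A x u) (view A y u) ↔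
      ∃ v ∈ errors x y, G.Adj (Sum.inl v) (Sum.inr u) := by
  rw [hammingDist_view, Nat.one_le_iff_ne_zero, Finset.card_ne_zero]
  simp_rw [← A.exists_right_iff]
  constructor
  · rintro ⟨j, hj⟩
    exact ⟨_, (mem_filter.1 hj).2, j, rfl⟩
  · rintro ⟨_, hv, j, rfl⟩
    exact ⟨j, by simpa using hv⟩

theorem expansion_errors {α δ : ℝ} (hG : IsBipartiteExpander G c d α δ) {x y : Fin n → ZMod 2}
    (h : ((errors x y).card : ℝ) ≤ α * n) :
    δ * c * (errors x y).card ≤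
      ((univ.filter fun u => 1 ≤ hammingDist (view A x u) (view A y u)).card : ℝ) := by
  convert hG.expansion _ h using 2
  rw [← Set.ncard_coe_finset]
  congr 1
  ext u
  simp [one_le_hammingDist_view]

theorem view_mem {y : Fin n → ZMod 2} (hy : y ∈ tannerCode A C₀) (u : Fin r) :
    view A y u ∈ C₀ := hy u

theorem one_le_hammingDist_of_mem_unsat {x y : Fin n → ZMod 2} (hy : y ∈ tannerCode A C₀)
    {u : Fin r} (hu : u ∈ unsat A C₀ x) : 1 ≤ hammingDist (view A x u) (view A y u) := by
  rw [Nat.one_le_iff_ne_zero, hammingDist_ne_zero]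
  intro h
  exact (mem_unsat A C₀).1 hu (h ▸ hy u)

theorem card_unsat_le {x y : Fin n → ZMod 2} (hy : y ∈ tannerCode A C₀) :
    (unsat A C₀ x).card ≤ c * (errors x y).card := by
  rw [← sum_hammingDist_view A x y, card_eq_sum_ones]
  refine (sum_le_sum fun u hu => one_le_hammingDist_of_mem_unsat A C₀ hy hu).trans ?_
  exact sum_le_sum_of_subset (subset_univ _)

variable {C₀} {d₀ : ℕ}

/-- Termwise: a satisfied constraint that sees an error reads a codeword of `C₀` other than that of
`y`, so it sees at least `d₀` errors; a violated one sees at least one, and the term `d₀ - 1` makes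
up the difference. -/
theorem mul_card_touched_le (hmin : ∀ z ∈ C₀, ∀ z' ∈ C₀, z ≠ z' → d₀ ≤ hammingDist z z')
    (hd₀ : 1 ≤ d₀) {x y : Fin n → ZMod 2} (hy : y ∈ tannerCode A C₀) :
    d₀ * (univ.filter fun u => 1 ≤ hammingDist (view A x u) (view A y u)).card ≤
      c * (errors x y).card + (d₀ - 1) * (unsat A C₀ x).card := by
  classical
  rw [← sum_hammingDist_view A x y, unsat, card_filter, card_filter, mul_sum, mul_sum,
    ← sum_add_distrib]
  refine sum_le_sum fun u _ => ?_
  by_cases h0 : view A x u = view A y u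
  · simp [h0]
  by_cases hu : view A x u ∈ C₀
  · have := hmin _ hu _ (view_mem A C₀ hy u) h0
    split_ifs <;> simp ; omega
  · have : hammingDist (view A x u) (view A y u) ≠ 0 := hammingDist_ne_zero.2 h0
    simp only [hu, not_false_eq_true, if_true]
    split_ifs <;> simp ; omega

/-- Termwise in the number `f` of errors seen by a constraint: `t + 1 ≤ f + t` if `1 ≤ f ≤ t`, `t +
1 ≤ f` in the middle range, and `(t + 1) + (d₀ - 2t - 1) = d₀ - t ≤ f` for the far constraints. -/
theorem mul_card_touched_add_le {t : ℕ}
    (ht : 2 * t + 1 ≤ d₀) (x y : Fin n → ZMod 2) :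
    (t + 1) * (univ.filter fun u => 1 ≤ hammingDist (view A x u) (view A y u)).card +
      (d₀ - 2 * t - 1) *
        (univ.filter fun u => d₀ - t ≤ hammingDist (view A x u) (view A y u)).card ≤
      c * (errors x y).card + t * (univ.filter fun u =>
        1 ≤ hammingDist (view A x u) (view A y u) ∧
          hammingDist (view A x u) (view A y u) ≤ t).card := by
  rw [← sum_hammingDist_view A x y, card_filter, card_filter, card_filter, mul_sum, mul_sum,
    mul_sum, ← sum_add_distrib, ← sum_add_distrib]
  refine sum_le_sum fun u _ => ?_
  generalize hammingDist (view A x u) (view A y u) = f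
  split_ifs <;> omega

/-- Markov's inequality for the number of errors seen by a constraint. -/
theorem mul_card_far_le (x y : Fin n → ZMod 2) (m : ℕ) :
    m * (univ.filter fun u => m ≤ hammingDist (view A x u) (view A y u)).card ≤
      c * (errors x y).card := by
  rw [← sum_hammingDist_view A x y, card_filter, mul_sum]
  refine sum_le_sum fun u _ => ?_
  split_ifs <;> simp ; omega

/-- A constraint votes for at most one variable, so no constraint is counted twice on the left. -/
theorem sum_votes (t : ℕ) (x : Fin n → ZMod 2) (S : Finset (Fin n)) :
    ∑ v ∈ S, votes A C₀ t x v =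
      ((unsat A C₀ x).filter fun u => ∃ v ∈ S, target A C₀ t x u = some v).card := by
  classical
  simp_rw [votes, card_filter]
  rw [sum_comm]
  refine sum_congr rfl fun u _ => ?_
  cases target A C₀ t x u with
  | none => simp
  | some w =>
    by_cases hw : w ∈ S
    · rw [if_pos ⟨w, hw, rfl⟩, sum_eq_single w]
      · simp
      · intro b _ hb; simp [Ne.symm hb]
      · exact fun h => absurd hw h
    · rw [if_neg, sum_eq_zero]
      · intro b hb
        rw [if_neg]
        rintro ⟨⟩
        exact hw hb
      · rintro ⟨b, hb, ⟨⟩⟩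
        exact hw hb

theorem sum_votes_le (t : ℕ) (x : Fin n → ZMod 2) (S : Finset (Fin n)) :
    ∑ v ∈ S, votes A C₀ t x v ≤ (unsat A C₀ x).card := by
  rw [sum_votes]
  exact card_filter_le _ _

theorem votes_le (t : ℕ) (x : Fin n → ZMod 2) (v : Fin n) : votes A C₀ t x v ≤ c := by
  classical
  have : ((unsat A C₀ x).filter fun u => target A C₀ t x u = some v) ⊆ univ.image (A.left v) := by
    intro u hu
    obtain ⟨j, hj, -⟩ := target_eq_some A C₀ (mem_filter.1 hu).2
    simpa using (A.exists_left_iff_exists_right u v).2 ⟨j, hj⟩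
  refine (card_le_card this).trans (card_image_le.trans ?_)
  simp

/-- At distance between `1` and `t` from the view of `y`, the view of `x` is not a codeword, and by
`2t < d₀` the view of `y` is the only codeword within `t`. The vote, whichever codeword it was
chosen with, therefore hits an error. -/
theorem card_near_le_sum_votes
    (hmin : ∀ z ∈ C₀, ∀ z' ∈ C₀, z ≠ z' → d₀ ≤ hammingDist z z') {t : ℕ} (ht : 2 * t + 1 ≤ d₀)
    {x y : Fin n → ZMod 2} (hy : y ∈ tannerCode A C₀) :
    (univ.filter fun u => 1 ≤ hammingDist (view A x u) (view A y u) ∧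
      hammingDist (view A x u) (view A y u) ≤ t).card ≤
      ∑ v ∈ errors x y, votes A C₀ t x v := by
  rw [sum_votes]
  refine card_le_card fun u hu => ?_
  obtain ⟨h1, h2⟩ := (mem_filter.1 hu).2
  have hne : view A x u ≠ view A y u := hammingDist_ne_zero.1 (by omega)
  refine mem_filter.2 ⟨(mem_unsat A C₀).2 fun h => ?_, ?_⟩
  · have := hmin _ h _ (view_mem A C₀ hy u) hne
    omega
  · obtain ⟨j, hj⟩ := exists_message C₀ (view_mem A C₀ hy u) h2 hne
    have hj' : target A C₀ t x u = some (A.right u j) := by simp [target, hj]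
    refine ⟨A.right u j, ?_, hj'⟩
    obtain ⟨z, hz, hz1, hz2⟩ := message_eq_some C₀ hj
    have : z = view A y u := by
      by_contra hzy
      have h3 := hmin _ hz _ (view_mem A C₀ hy u) hzy
      have h4 := hammingDist_triangle z (view A x u) (view A y u)
      rw [hammingDist_comm z (view A x u)] at h4
      omega
    rw [mem_errors]
    rw [this] at hz2
    exact hz2

/-- A vote for a correct variable was cast with a codeword `z` other than the view of `y`; since `z`
is within `t` of the view of `x`, the triangle inequality puts the latter at distance at least `d₀ -
t` from the view of `y`. -/
theorem sum_votes_compl_le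
    (hmin : ∀ z ∈ C₀, ∀ z' ∈ C₀, z ≠ z' → d₀ ≤ hammingDist z z') (t : ℕ)
    {x y : Fin n → ZMod 2} (hy : y ∈ tannerCode A C₀) :
    ∑ v ∈ (errors x y)ᶜ, votes A C₀ t x v ≤
      (univ.filter fun u => d₀ - t ≤ hammingDist (view A x u) (view A y u)).card := by
  rw [sum_votes]
  refine card_le_card fun u hu => mem_filter.2 ⟨mem_univ _, ?_⟩
  obtain ⟨v, hv, htv⟩ := (mem_filter.1 hu).2
  obtain ⟨j, rfl, z, hz, hz1, hz2⟩ := target_eq_some A C₀ htv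
  rw [mem_compl, mem_errors, not_not] at hv
  have hzy : z ≠ view A y u := by
    rintro rfl
    exact hz2 hv
  have h3 := hmin _ hz _ (view_mem A C₀ hy u) hzy
  have h4 := hammingDist_triangle z (view A x u) (view A y u)
  rw [hammingDist_comm z (view A x u)] at h4
  omega

theorem zmod_two_add_one_ne {a b : ZMod 2} : a + 1 ≠ b ↔ a = b := by
  revert a b; decide

theorem errors_flipStep (t q : ℕ) (x y : Fin n → ZMod 2) :
    errors (flipStep A C₀ t q x) y =
      ((errors x y).filter fun v => ¬ q ≤ votes A C₀ t x v) ∪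
        ((errors x y)ᶜ.filter fun v => q ≤ votes A C₀ t x v) := by
  ext v
  simp only [mem_union, mem_filter, mem_compl, mem_errors, flipStep]
  split_ifs with h <;> simp [h, zmod_two_add_one_ne]

theorem card_errors_flipStep (t q : ℕ) (x y : Fin n → ZMod 2) :
    (errors (flipStep A C₀ t q x) y).card +
        ((errors x y).filter fun v => q ≤ votes A C₀ t x v).card =
      (errors x y).card + ((errors x y)ᶜ.filter fun v => q ≤ votes A C₀ t x v).card := by
  rw [errors_flipStep, card_union_of_disjoint]
  · have := card_filter_add_card_filter_not (s := errors x y) fun v => q ≤ votes A C₀ t x v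
    omega
  · refine disjoint_left.2 fun v h1 h2 => ?_
    exact (mem_filter.1 h1).2 (mem_filter.1 h2).2

/-- Layer-cake summation; the levels stop at `c` because a variable has only `c` possible voters. -/
theorem sum_card_filter_votes (t : ℕ) (x : Fin n → ZMod 2) (S : Finset (Fin n)) :
    ∑ q ∈ Icc 1 c, (S.filter fun v => q ≤ votes A C₀ t x v).card =
      ∑ v ∈ S, votes A C₀ t x v := by
  simp_rw [card_filter]
  rw [sum_comm]
  refine sum_congr rfl fun v _ => ?_
  rw [← card_filter]
  have : (Icc 1 c).filter (fun q => q ≤ votes A C₀ t x v) = Icc 1 (votes A C₀ t x v) := by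
    ext q
    have := votes_le (C₀ := C₀) A t x v
    simp only [mem_filter, mem_Icc]
    omega
  simp [this]

/-- Some threshold removes a constant fraction of the errors. -/
theorem exists_flipStep_progress {α δ : ℝ} (hG : IsBipartiteExpander G c d α δ) (hc : 0 < c)
    (hmin : ∀ z ∈ C₀, ∀ z' ∈ C₀, z ≠ z' → d₀ ≤ hammingDist z z') {t : ℕ} (ht1 : 1 ≤ t)
    (ht : 3 * t + 1 ≤ d₀) {x y : Fin n → ZMod 2} (hy : y ∈ tannerCode A C₀)
    (hx : ((errors x y).card : ℝ) ≤ α * n) :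
    ∃ q ∈ Icc 1 c, ((errors (flipStep A C₀ t q x) y).card : ℝ) ≤
      (1 - ((t + 1) * δ - 1) / t) * (errors x y).card := by
  -- Averaging over the thresholds: if every `q` gained less than the claimed fraction, the `c`
  -- gains would add up to less than `a - b`.
  by_contra! hcon
  have h1 := mul_card_touched_add_le A (d₀ := d₀) (t := t) (by omega) x y
  have h2 := card_near_le_sum_votes A hmin (t := t) (by omega) (x := x) hy
  have h3 := sum_votes_compl_le A hmin t (x := x) hy
  have h4 := expansion_errors A hG hx
  set N := (univ.filter fun u => 1 ≤ hammingDist (view A x u) (view A y u)).card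
  set a := (univ.filter fun u => 1 ≤ hammingDist (view A x u) (view A y u) ∧
      hammingDist (view A x u) (view A y u) ≤ t).card
  set b := (univ.filter fun u => d₀ - t ≤ hammingDist (view A x u) (view A y u)).card
  rw [← sum_card_filter_votes] at h2 h3
  -- This is where `3t + 1 ≤ d₀` enters: the weight `d₀ - 2t - 1` of the far constraints is at least
  -- `t`, so near and far constraints can be compared with equal weight.
  have h5 : (t + 1) * N + t * b ≤ c * (errors x y).card + t * a :=
    le_trans (by gcongr; omega) h1
  have htR : (0 : ℝ) < t := by exact_mod_cast ht1
  have h6 : ((t : ℝ) + 1) * N + t * b ≤ c * (errors x y).card + t * a := by exact_mod_cast h5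
  have h7 : ((t : ℝ) + 1) * (δ * c * (errors x y).card) ≤ (t + 1) * N := by gcongr
  have h8 : ((t + 1) * δ - 1) / t * (c * (errors x y).card) ≤ (a : ℝ) - b := by
    rw [div_mul_eq_mul_div, div_le_iff₀ htR]
    linarith
  have h9 : ∀ q ∈ Icc 1 c, (((errors x y).filter fun v => q ≤ votes A C₀ t x v).card : ℝ) -
      ((errors x y)ᶜ.filter fun v => q ≤ votes A C₀ t x v).card <
      ((t + 1) * δ - 1) / t * (errors x y).card := by
    intro q hq
    have h10 := hcon q hq
    have h11 : ((errors (flipStep A C₀ t q x) y).card : ℝ) +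
        ((errors x y).filter fun v => q ≤ votes A C₀ t x v).card =
      (errors x y).card + ((errors x y)ᶜ.filter fun v => q ≤ votes A C₀ t x v).card := by
      exact_mod_cast card_errors_flipStep A t q x y
    linarith
  have h12 := sum_lt_sum_of_nonempty ⟨1, by simp; omega⟩ h9
  rw [sum_sub_distrib, sum_const, Nat.card_Icc, nsmul_eq_mul] at h12
  have h13 : (a : ℝ) ≤ ∑ q ∈ Icc 1 c,
      (((errors x y).filter fun v => q ≤ votes A C₀ t x v).card : ℝ) := by exact_mod_cast h2
  have h14 : ∑ q ∈ Icc 1 c,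
      (((errors x y)ᶜ.filter fun v => q ≤ votes A C₀ t x v).card : ℝ) ≤ b := by exact_mod_cast h3
  have h15 : ((c + 1 - 1 : ℕ) : ℝ) = c := by simp
  rw [h15] at h12
  linarith

/-- No threshold introduces many errors. -/
theorem card_errors_flipStep_le
    (hmin : ∀ z ∈ C₀, ∀ z' ∈ C₀, z ≠ z' → d₀ ≤ hammingDist z z') {t q : ℕ} (hq : 1 ≤ q)
    {x y : Fin n → ZMod 2} (hy : y ∈ tannerCode A C₀) :
    (d₀ - t) * (errors (flipStep A C₀ t q x) y).card ≤
      (d₀ - t + c) * (errors x y).card := by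
  -- Each newly created error has received at least one vote, all these votes come from constraints
  -- seeing at least `d₀ - t` errors, and there are at most `c|F|/(d₀ - t)` of those.
  have h1 := card_errors_flipStep (C₀ := C₀) A t q x y
  have h2 := sum_votes_compl_le A hmin t (x := x) hy
  have h3 := mul_card_far_le A x y (d₀ - t)
  have h4 : ((errors x y)ᶜ.filter fun v => q ≤ votes A C₀ t x v).card ≤
      ∑ v ∈ (errors x y)ᶜ, votes A C₀ t x v := by
    rw [card_filter]
    refine sum_le_sum fun v _ => ?_
    split_ifs <;> omega
  have h5 := Nat.mul_le_mul_left (d₀ - t) (h4.trans h2)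
  have h6 : (d₀ - t) * (errors (flipStep A C₀ t q x) y).card ≤
      (d₀ - t) * ((errors x y).card +
        ((errors x y)ᶜ.filter fun v => q ≤ votes A C₀ t x v).card) :=
    Nat.mul_le_mul_left _ (by omega)
  linarith

/-- Few errors leave their trace in the number of violated constraints. -/
theorem card_errors_le_card_unsat {α δ : ℝ} (hG : IsBipartiteExpander G c d α δ)
    (hmin : ∀ z ∈ C₀, ∀ z' ∈ C₀, z ≠ z' → d₀ ≤ hammingDist z z') (hd₀ : 1 ≤ d₀)
    {x y : Fin n → ZMod 2} (hy : y ∈ tannerCode A C₀) (hx : ((errors x y).card : ℝ) ≤ α * n) :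
    (δ * d₀ - 1) * (c * (errors x y).card) ≤ (d₀ - 1) * (unsat A C₀ x).card := by
  have h1 := expansion_errors A hG hx
  have h2 := mul_card_touched_le A hmin hd₀ (x := x) hy
  set N := (univ.filter fun u => 1 ≤ hammingDist (view A x u) (view A y u)).card
  have h3 : (d₀ : ℝ) * N ≤ c * (errors x y).card + (d₀ - 1) * (unsat A C₀ x).card := by
    have : ((d₀ - 1 : ℕ) : ℝ) = d₀ - 1 := by simp [hd₀]
    rw [← this]
    exact_mod_cast h2
  have h4 : (d₀ : ℝ) * (δ * c * (errors x y).card) ≤ d₀ * N := by gcongr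
  linarith

/-- Changing a few variables violates few new constraints. -/
theorem card_unsat_le_add {x x' : Fin n → ZMod 2} :
    (unsat A C₀ x').card ≤ (unsat A C₀ x).card + c * (errors x' x).card := by
  classical
  have h : unsat A C₀ x' ⊆ unsat A C₀ x ∪
      univ.filter fun u => 1 ≤ hammingDist (view A x' u) (view A x u) := by
    intro u hu
    rw [mem_union, or_iff_not_imp_left]
    intro hu'
    rw [mem_unsat, not_not] at hu'
    refine mem_filter.2 ⟨mem_univ _, ?_⟩
    rw [Nat.one_le_iff_ne_zero, hammingDist_ne_zero]
    intro h
    rw [mem_unsat, h] at hu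
    exact hu hu'
  have h1 := mul_card_far_le A x' x 1
  have h2 := (card_le_card h).trans (card_union_le _ _)
  omega

theorem errors_flipStep_self (t q : ℕ) (x : Fin n → ZMod 2) :
    errors (flipStep A C₀ t q x) x = univ.filter fun v => q ≤ votes A C₀ t x v := by
  ext v
  simp only [mem_errors, mem_filter, mem_univ, true_and, flipStep]
  split_ifs with h <;> simp [h]

/-- Every flipped variable uses up at least one vote, and there are at most as many votes as
violated constraints. This bounds the flipping work of a step by the length of the list. -/
theorem card_flipped_le {t q : ℕ} (hq : 1 ≤ q) (x : Fin n → ZMod 2) :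
    (univ.filter fun v => q ≤ votes A C₀ t x v).card ≤ (unsat A C₀ x).card := by
  refine le_trans ?_ (sum_votes_le (C₀ := C₀) A t x univ)
  rw [card_filter]
  refine sum_le_sum fun v _ => ?_
  split_ifs <;> omega

/-- Needed for the running time only, hence without any assumption on the word or on expansion: even
a bad threshold enlarges the list of violated constraints by at most a constant factor. -/
theorem card_unsat_flipStep_le {t q : ℕ} (hq : 1 ≤ q) (x : Fin n → ZMod 2) :
    (unsat A C₀ (flipStep A C₀ t q x)).card ≤ (1 + c) * (unsat A C₀ x).card := by
  have h1 := card_unsat_le_add (C₀ := C₀) A (x := x) (x' := flipStep A C₀ t q x)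
  rw [errors_flipStep_self] at h1
  have h2 := Nat.mul_le_mul_left c (card_flipped_le (C₀ := C₀) A (t := t) hq x)
  linarith

end Combinatorics

/-! ### Choice of the parameters. -/

/-- The numerical conditions on the parameters of the decoder: votes within distance `t`, rounds of
`s` steps, and the threshold `a / B` for the fraction of violated constraints. -/
structure IsTuned (c d₀ t B a s : ℕ) (α δ γ : ℝ) : Prop where
  c_pos : 0 < c
  t_pos : 1 ≤ t
  t_le : 3 * t + 1 ≤ d₀
  le_B : d₀ ≤ B
  gamma_nonneg : 0 ≤ γ
  delta_gt : 2 < δ * d₀ - 1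
  delta_le : δ ≤ 1
  rate_nonneg : 1 ≤ (t + 1) * δ
  start : ((d₀ - t : ℕ) + c) * γ ≤ (d₀ - t : ℕ) * α
  threshold : c * γ * B ≤ a
  middle : ((d₀ - t : ℕ) + c) * ((d₀ - 1) * a) ≤ (d₀ - t : ℕ) * α * (B * ((δ * d₀ - 1) * c))
  steps : (1 - ((t + 1) * δ - 1) / t) ^ s * B * (d₀ - 1) ≤ δ * d₀ - 1

/-- In `IsTuned`, `start` says that one arbitrary step from `γn` errors stays below `αn`,
`threshold` that `γn` errors pass the test on violated constraints, `middle` that passing this test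
below `αn` errors allows another arbitrary step, and `steps` that `s` good steps divide the number
of violated constraints by `B`. -/
theorem exists_isTuned {c d₀ : ℕ} {α δ : ℝ} (hc : 0 < c) (hα : 0 < α) (hδ : 0 < δ) (hδ1 : δ ≤ 1)
    (h : 3 < δ * d₀) :
    ∃ t B a s, IsTuned c d₀ t B a s α δ (2 * α / (d₀ * (1 + 0.5 * c * δ))) := by
  have hd : (3 : ℝ) < d₀ := by nlinarith
  have hd' : 3 < d₀ := by exact_mod_cast hd
  have hc' : (0 : ℝ) < c := by exact_mod_cast hc
  -- The lower bound on `d₀` makes far constraints rare enough; the upper one turns `δd₀ > 3` into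
  -- `(t + 1)δ > 1`.
  obtain ⟨t, ht1, ht2⟩ : ∃ t, 3 * t + 1 ≤ d₀ ∧ d₀ ≤ 3 * t + 3 := ⟨(d₀ - 1) / 3, by omega, by omega⟩
  have ht : 1 ≤ t := by omega
  have htR : (1 : ℝ) ≤ t := by exact_mod_cast ht
  have ht1R : 3 * (t : ℝ) + 1 ≤ d₀ := by exact_mod_cast ht1
  have ht2R : (d₀ : ℝ) ≤ 3 * t + 3 := by exact_mod_cast ht2
  set γ := 2 * α / (d₀ * (1 + 0.5 * c * δ)) with hγ
  have hden : 0 < d₀ * (1 + 0.5 * c * δ) := by positivity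
  have hγ0 : 0 < γ := by positivity
  have hγe : γ * d₀ * (1 + 0.5 * c * δ) = 2 * α := by
    rw [hγ]; field_simp
  have hrate : 1 < (t + 1) * δ := by nlinarith
  -- `B ≥ d₀` makes accepted rounds return to the radius `γn`, and `Bcγ ≥ d₀` absorbs the rounding
  -- in `⌈cγB⌉`.
  obtain ⟨B, hB⟩ := exists_nat_ge (max (d₀ : ℝ) (d₀ / (c * γ)))
  have hB1 : (d₀ : ℝ) ≤ B := (le_max_left _ _).trans hB
  have hB2 : (d₀ : ℝ) ≤ B * (c * γ) := by
    rw [← div_le_iff₀ (by positivity)]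
    exact (le_max_right _ _).trans hB
  have hBpos : (0 : ℝ) < B := by linarith
  obtain ⟨s, hs⟩ := exists_pow_lt_of_lt_one (x := (δ * d₀ - 1) / (B * (d₀ - 1)))
    (y := 1 - ((t + 1) * δ - 1) / t) (div_pos (by linarith) (mul_pos hBpos (by linarith)))
    (by
      have : 0 < ((t + 1) * δ - 1) / (t : ℝ) := div_pos (by linarith) (by linarith)
      linarith)
  have hsub : ((d₀ - t : ℕ) : ℝ) = d₀ - t := by rw [Nat.cast_sub (by omega)]
  -- Since `3t < d₀`, `δ(d₀ - t) ≥ (2/3)δd₀ > 2`, so `c ≤ (d₀ - t) · 0.5cδ`. The factor `1 + 0.5cδ`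
  -- in `γ` thus dominates the growth `1 + c/(d₀ - t)` of the errors in one step.
  have hcore : ((d₀ : ℝ) - t + c) ≤ (d₀ - t) * (1 + 0.5 * c * δ) := by
    have : 2 ≤ δ * (d₀ - t) := by nlinarith
    nlinarith
  refine ⟨t, B, ⌈c * γ * B⌉₊, s, hc, ht, ht1, by exact_mod_cast hB1, hγ0.le, by linarith, hδ1,
    hrate.le, ?_, Nat.le_ceil _, ?_, ?_⟩
  · rw [hsub]
    have h1 : ((d₀ : ℝ) - t + c) * γ ≤ (d₀ - t) * (1 + 0.5 * c * δ) * γ := by gcongr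
    have h2 : (d₀ - t) * ((1 + 0.5 * c * δ) * γ) ≤ (d₀ - t) * α := by
      have : (1 + 0.5 * c * δ) * γ ≤ α := by nlinarith [mul_pos hγ0 (by positivity : 0 < 1 + 0.5 * c * δ)]
      have h0 : (0 : ℝ) ≤ d₀ - t := by linarith
      gcongr
    linarith
  · rw [hsub]
    have h1 : ((⌈c * γ * B⌉₊ : ℕ) : ℝ) ≤ c * γ * B + 1 := (Nat.ceil_lt_add_one (by positivity)).le
    have h0 : (0 : ℝ) ≤ d₀ - 1 := by linarith
    -- `(d₀ - 1)(cγB + 1) ≤ d₀cγB` amounts to `d₀ - 1 ≤ cγB`, which is the second lower bound on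
    -- `B`.
    have h2 : (d₀ - 1) * ((⌈c * γ * B⌉₊ : ℕ) : ℝ) ≤ d₀ * (c * γ * B) := by
      have : ((d₀ : ℝ) - 1) * ((⌈c * γ * B⌉₊ : ℕ) : ℝ) ≤ (d₀ - 1) * (c * γ * B + 1) := by gcongr
      nlinarith
    have h3 : (0 : ℝ) ≤ d₀ - t := by linarith
    calc ((d₀ : ℝ) - t + c) * ((d₀ - 1) * ((⌈c * γ * B⌉₊ : ℕ) : ℝ))
        ≤ ((d₀ - t) * (1 + 0.5 * c * δ)) * (d₀ * (c * γ * B)) := by gcongr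
      _ = (d₀ - t) * (γ * d₀ * (1 + 0.5 * c * δ)) * (B * c) := by ring
      _ = (d₀ - t) * α * (B * (2 * c)) := by rw [hγe]; ring
      _ ≤ (d₀ - t) * α * (B * ((δ * d₀ - 1) * c)) := by gcongr; linarith
  · rw [mul_assoc, ← le_div_iff₀ (mul_pos hBpos (by linarith))]
    exact hs.le

/-! ### Lists of thresholds, and why the acceptance test is sound and complete. -/

section Rounds

variable {n r c d : ℕ} {G : SimpleGraph (Fin n ⊕ Fin r)} (A : AdjacencyLists G c d)
  (C₀ : Submodule (ZMod 2) (Fin d → ZMod 2))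

/-- The word after flipping steps with the thresholds in a list. -/
noncomputable def flipSteps (t : ℕ) : List ℕ → (Fin n → ZMod 2) → Fin n → ZMod 2
  | [], x => x
  | q :: σ, x => flipSteps t σ (flipStep A C₀ t q x)

/-- After each of the steps, at most `m / B` constraints are violated. -/
def StaysBelow (t B m : ℕ) : List ℕ → (Fin n → ZMod 2) → Prop
  | [], _ => True
  | q :: σ, x => B * (unsat A C₀ (flipStep A C₀ t q x)).card ≤ m ∧
      StaysBelow t B m σ (flipStep A C₀ t q x)

/-- The condition under which the decoder accepts the outcome of a list of steps. -/
def Accepts (t B m : ℕ) (σ : List ℕ) (x : Fin n → ZMod 2) : Prop :=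
  StaysBelow A C₀ t B m σ x ∧
    B * (unsat A C₀ (flipSteps A C₀ t σ x)).card ≤ (unsat A C₀ x).card

/-- All lists of `s` thresholds between `1` and `c`. -/
def thresholdLists (c : ℕ) : ℕ → List (List ℕ)
  | 0 => [[]]
  | s + 1 => (List.range c).flatMap fun q => (thresholdLists c s).map fun σ => (q + 1) :: σ

theorem mem_thresholdLists {c s : ℕ} {σ : List ℕ} :
    σ ∈ thresholdLists c s ↔ σ.length = s ∧ ∀ q ∈ σ, q ∈ Icc 1 c := by
  induction s generalizing σ with
  | zero =>
    simp only [thresholdLists, List.mem_singleton, List.length_eq_zero_iff]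
    constructor
    · rintro rfl; simp
    · exact fun h => h.1
  | succ s ih =>
    simp only [thresholdLists, List.mem_flatMap, List.mem_range, List.mem_map, ih]
    constructor
    · rintro ⟨q, hq, τ, ⟨h1, h2⟩, rfl⟩
      refine ⟨by simp [h1], fun q' hq' => ?_⟩
      rcases List.mem_cons.1 hq' with rfl | hq'
      · simp; omega
      · exact h2 _ hq'
    · rintro ⟨h1, h2⟩
      cases σ with
      | nil => simp at h1
      | cons q τ =>
        have hq := mem_Icc.1 (h2 q (by simp))
        refine ⟨q - 1, by omega, τ, ⟨by simpa using h1, fun q' hq' => h2 _ (by simp [hq'])⟩, ?_⟩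
        congr 1
        omega

variable {C₀} {d₀ t B a s : ℕ} {α δ γ : ℝ}

theorem IsTuned.le_of_small (hT : IsTuned c d₀ t B a s α δ γ) {f m : ℝ} (hf : 0 ≤ f)
    (h : ((d₀ - t : ℕ) + c) * f ≤ (d₀ - t : ℕ) * (α * m)) : f ≤ α * m := by
  have h1 : (0 : ℝ) < ((d₀ - t : ℕ) : ℝ) := by
    have := hT.t_le
    exact_mod_cast (by omega : 0 < d₀ - t)
  have h2 : (0 : ℝ) ≤ c * f := by positivity
  exact le_of_mul_le_mul_left (by linarith) h1

theorem IsTuned.gamma_le (hT : IsTuned c d₀ t B a s α δ γ) : γ ≤ α := by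
  have := hT.le_of_small (m := 1) hT.gamma_nonneg (by simpa using hT.start)
  simpa using this

theorem IsTuned.one_lt (hT : IsTuned c d₀ t B a s α δ γ) : (1 : ℝ) < d₀ := by
  have h1 := hT.t_le
  have h2 := hT.t_pos
  exact_mod_cast (by omega : 1 < d₀)

/-- The hypothesis `hx` leaves room for one step with any threshold. After that step at most `αn`
positions are wrong, so few violated constraints mean few errors, and by `middle` the test restores
`hx` for the next step. The test after the final step is not needed for the conclusion itself. -/
theorem card_errors_flipSteps_le (hT : IsTuned c d₀ t B a s α δ γ)
    (hG : IsBipartiteExpander G c d α δ)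
    (hmin : ∀ z ∈ C₀, ∀ z' ∈ C₀, z ≠ z' → d₀ ≤ hammingDist z z')
    {y : Fin n → ZMod 2} (hy : y ∈ tannerCode A C₀) {σ : List ℕ} (hσ : ∀ q ∈ σ, 1 ≤ q)
    {x : Fin n → ZMod 2}
    (hx : ((d₀ - t : ℕ) + c) * ((errors x y).card : ℝ) ≤ (d₀ - t : ℕ) * (α * n))
    (hb : StaysBelow A C₀ t B (a * n) σ x) :
    ((errors (flipSteps A C₀ t σ x) y).card : ℝ) ≤ α * n := by
  induction σ generalizing x with
  | nil => exact hT.le_of_small (by positivity) hx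
  | cons q σ ih =>
    have htd := hT.t_le
    have hpos : (0 : ℝ) < ((d₀ - t : ℕ) : ℝ) := by exact_mod_cast (by omega : 0 < d₀ - t)
    have h1 : (d₀ - t : ℕ) * ((errors (flipStep A C₀ t q x) y).card : ℝ) ≤
        ((d₀ - t : ℕ) + c) * ((errors x y).card : ℝ) := by
      exact_mod_cast card_errors_flipStep_le A hmin (t := t) (hσ q (by simp)) (x := x) hy
    have h2 : ((errors (flipStep A C₀ t q x) y).card : ℝ) ≤ α * n :=
      le_of_mul_le_mul_left (h1.trans hx) hpos
    refine ih (fun q' hq' => hσ q' (by simp [hq'])) ?_ hb.2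
    have h3 := card_errors_le_card_unsat A hG hmin (by omega) hy h2
    set f := ((errors (flipStep A C₀ t q x) y).card : ℝ)
    have h4 : B * ((unsat A C₀ (flipStep A C₀ t q x)).card : ℝ) ≤ a * n := by exact_mod_cast hb.1
    have h5 := hT.one_lt
    have h6 := hT.delta_gt
    have hB : (0 : ℝ) < B := by
      have := hT.le_B
      exact_mod_cast (by omega : 0 < B)
    have hc : (0 : ℝ) < c := by exact_mod_cast hT.c_pos
    have h7 : B * ((δ * d₀ - 1) * c) * f ≤ (d₀ - 1) * a * n := by
      calc B * ((δ * d₀ - 1) * c) * f = B * ((δ * d₀ - 1) * (c * f)) := by ring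
        _ ≤ B * ((d₀ - 1) * (unsat A C₀ (flipStep A C₀ t q x)).card) := by gcongr
        _ = (d₀ - 1) * (B * (unsat A C₀ (flipStep A C₀ t q x)).card) := by ring
        _ ≤ (d₀ - 1) * (a * n) := by
          have : (0 : ℝ) ≤ d₀ - 1 := by linarith
          gcongr
        _ = _ := by ring
    have hK : 0 < B * ((δ * d₀ - 1) * c) := by
      have : 0 < δ * d₀ - 1 := by linarith
      positivity
    refine le_of_mul_le_mul_left ?_ hK
    calc B * ((δ * d₀ - 1) * c) * (((d₀ - t : ℕ) + c) * f)
        = ((d₀ - t : ℕ) + c) * (B * ((δ * d₀ - 1) * c) * f) := by ring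
      _ ≤ ((d₀ - t : ℕ) + c) * ((d₀ - 1) * a * n) := by gcongr
      _ = ((d₀ - t : ℕ) + c) * ((d₀ - 1) * a) * n := by ring
      _ ≤ (d₀ - t : ℕ) * α * (B * ((δ * d₀ - 1) * c)) * n := mul_le_mul_of_nonneg_right hT.middle (by positivity)
      _ = _ := by ring

/-- An accepted round keeps the word within the decoding radius. -/
theorem card_errors_le_of_accepts (hT : IsTuned c d₀ t B a s α δ γ)
    (hG : IsBipartiteExpander G c d α δ)
    (hmin : ∀ z ∈ C₀, ∀ z' ∈ C₀, z ≠ z' → d₀ ≤ hammingDist z z')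
    {y : Fin n → ZMod 2} (hy : y ∈ tannerCode A C₀) {σ : List ℕ} (hσ : ∀ q ∈ σ, 1 ≤ q)
    {x : Fin n → ZMod 2} (hx : ((errors x y).card : ℝ) ≤ γ * n)
    (ha : Accepts A C₀ t B (a * n) σ x) :
    ((errors (flipSteps A C₀ t σ x) y).card : ℝ) ≤ γ * n := by
  have hstart : ((d₀ - t : ℕ) + c) * ((errors x y).card : ℝ) ≤ (d₀ - t : ℕ) * (α * n) := by
    calc ((d₀ - t : ℕ) + c) * ((errors x y).card : ℝ) ≤ ((d₀ - t : ℕ) + c) * (γ * n) := by gcongr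
      _ = ((d₀ - t : ℕ) + c) * γ * n := by ring
      _ ≤ (d₀ - t : ℕ) * α * n := mul_le_mul_of_nonneg_right hT.start (by positivity)
      _ = _ := by ring
  have h1 := card_errors_flipSteps_le A hT hG hmin hy hσ hstart ha.1
  have htd := hT.t_le
  have h2 := card_errors_le_card_unsat A hG hmin (by omega) hy h1
  have h3 : B * ((unsat A C₀ (flipSteps A C₀ t σ x)).card : ℝ) ≤ c * (errors x y).card := by
    exact_mod_cast ha.2.trans (card_unsat_le A C₀ hy)
  set f := ((errors (flipSteps A C₀ t σ x) y).card : ℝ)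
  have h5 := hT.one_lt
  have h6 := hT.delta_gt
  have hB : (d₀ : ℝ) ≤ B := by exact_mod_cast hT.le_B
  have hc : (0 : ℝ) < c := by exact_mod_cast hT.c_pos
  have h0 : (0 : ℝ) ≤ d₀ - 1 := by linarith
  have hγn : 0 ≤ c * (γ * n) := by have := hT.gamma_nonneg; positivity
  have hK : 0 < B * ((δ * d₀ - 1) * c) :=
    mul_pos (by linarith) (mul_pos (by linarith) hc)
  refine le_of_mul_le_mul_left ?_ hK
  calc B * ((δ * d₀ - 1) * c) * f = B * ((δ * d₀ - 1) * (c * f)) := by ring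
    _ ≤ B * ((d₀ - 1) * (unsat A C₀ (flipSteps A C₀ t σ x)).card) := by gcongr
    _ = (d₀ - 1) * (B * (unsat A C₀ (flipSteps A C₀ t σ x)).card) := by ring
    _ ≤ (d₀ - 1) * (c * (γ * n)) := mul_le_mul_of_nonneg_left (h3.trans (by gcongr)) h0
    _ ≤ (B * (δ * d₀ - 1)) * (c * (γ * n)) := by
      gcongr
      -- `d₀ - 1 ≤ B(δd₀ - 1)`, from `d₀ ≤ B` and `δd₀ - 1 > 2`.
      nlinarith
    _ = _ := by ring

/-- Within the decoding radius, some list of thresholds is accepted. -/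
theorem exists_accepts (hT : IsTuned c d₀ t B a s α δ γ)
    (hG : IsBipartiteExpander G c d α δ)
    (hmin : ∀ z ∈ C₀, ∀ z' ∈ C₀, z ≠ z' → d₀ ≤ hammingDist z z')
    {y : Fin n → ZMod 2} (hy : y ∈ tannerCode A C₀)
    {x : Fin n → ZMod 2} (hx : ((errors x y).card : ℝ) ≤ γ * n) :
    ∃ σ ∈ thresholdLists c s, Accepts A C₀ t B (a * n) σ x := by
  have htR : (1 : ℝ) ≤ t := by exact_mod_cast hT.t_pos
  set ρ : ℝ := 1 - ((t + 1) * δ - 1) / t with hρ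
  have hρ1 : ρ ≤ 1 := by
    have : 0 ≤ ((t + 1) * δ - 1) / t := div_nonneg (by linarith [hT.rate_nonneg]) (by linarith)
    linarith
  have hρ0 : 0 ≤ ρ := by
    have : ((t + 1) * δ - 1) / t ≤ 1 := by
      rw [div_le_one (by linarith)]
      nlinarith [hT.delta_le]
    linarith
  have hB0 : (0 : ℝ) ≤ B := by positivity
  have hγα : γ * n ≤ α * n := by gcongr; exact hT.gamma_le
  -- With a good threshold at every step the errors never exceed `γn`, so the intermediate tests
  -- hold at once, by `threshold`.
  have key : ∀ k, ∀ x : Fin n → ZMod 2, ((errors x y).card : ℝ) ≤ γ * n →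
      ∃ σ ∈ thresholdLists c k, StaysBelow A C₀ t B (a * n) σ x ∧
        ((errors (flipSteps A C₀ t σ x) y).card : ℝ) ≤ ρ ^ k * (errors x y).card := by
    intro k
    induction k with
    | zero => intro x hx; exact ⟨[], by simp [thresholdLists], trivial, by simp [flipSteps]⟩
    | succ k ih =>
      intro x hx
      obtain ⟨q, hq, hq'⟩ := exists_flipStep_progress A hG hT.c_pos hmin hT.t_pos hT.t_le hy
        (hx.trans hγα)
      rw [← hρ] at hq'
      have hx' : ((errors (flipStep A C₀ t q x) y).card : ℝ) ≤ γ * n :=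
        hq'.trans ((mul_le_of_le_one_left (by positivity) hρ1).trans hx)
      obtain ⟨σ, hσ, hb, hf⟩ := ih _ hx'
      rw [mem_thresholdLists] at hσ
      refine ⟨q :: σ, mem_thresholdLists.2 ⟨by simp [hσ.1], ?_⟩, ⟨?_, hb⟩, ?_⟩
      · intro q' hq'
        rcases List.mem_cons.1 hq' with rfl | h
        · exact hq
        · exact hσ.2 _ h
      · have h1 : ((unsat A C₀ (flipStep A C₀ t q x)).card : ℝ) ≤
            c * (errors (flipStep A C₀ t q x) y).card := by exact_mod_cast card_unsat_le A C₀ hy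
        have h2 : (B : ℝ) * (unsat A C₀ (flipStep A C₀ t q x)).card ≤ a * n := by
          calc (B : ℝ) * (unsat A C₀ (flipStep A C₀ t q x)).card ≤ B * (c * (γ * n)) := by
                gcongr; exact h1.trans (by gcongr)
            _ = c * γ * B * n := by ring
            _ ≤ a * n := by gcongr; exact hT.threshold
        exact_mod_cast h2
      · refine hf.trans ?_
        rw [pow_succ, mul_assoc]
        gcongr
  obtain ⟨σ, hσ, hb, hf⟩ := key s x hx
  refine ⟨σ, hσ, hb, ?_⟩
  have htd := hT.t_le
  have h1 := card_errors_le_card_unsat A hG hmin (by omega) hy (hx.trans hγα)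
  have h2 : ((unsat A C₀ (flipSteps A C₀ t σ x)).card : ℝ) ≤
      c * (errors (flipSteps A C₀ t σ x) y).card := by exact_mod_cast card_unsat_le A C₀ hy
  have h3 := hT.one_lt
  have h0 : (0 : ℝ) < d₀ - 1 := by linarith
  -- The shrinkage of the errors is transferred to the violated constraints by the comparison in
  -- both directions; `steps` pays for the loss `(d₀ - 1)/(δd₀ - 1)` in it.
  have h4 : (B : ℝ) * (unsat A C₀ (flipSteps A C₀ t σ x)).card ≤ (unsat A C₀ x).card := by
    refine le_of_mul_le_mul_left ?_ h0
    calc ((d₀ : ℝ) - 1) * (B * (unsat A C₀ (flipSteps A C₀ t σ x)).card)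
        ≤ (d₀ - 1) * (B * (c * (ρ ^ s * (errors x y).card))) := by
          gcongr; exact h2.trans (by gcongr)
      _ = ρ ^ s * B * (d₀ - 1) * (c * (errors x y).card) := by ring
      _ ≤ (δ * d₀ - 1) * (c * (errors x y).card) := by gcongr; exact hT.steps
      _ ≤ _ := h1
  exact_mod_cast h4

/-- With no violated constraint the comparison reads `(δd₀ - 1)c|F| ≤ 0`. -/
theorem eq_of_unsat_eq_empty (hT : IsTuned c d₀ t B a s α δ γ)
    (hG : IsBipartiteExpander G c d α δ)
    (hmin : ∀ z ∈ C₀, ∀ z' ∈ C₀, z ≠ z' → d₀ ≤ hammingDist z z')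
    {y : Fin n → ZMod 2} (hy : y ∈ tannerCode A C₀)
    {x : Fin n → ZMod 2} (hx : ((errors x y).card : ℝ) ≤ γ * n) (h : unsat A C₀ x = ∅) :
    x = y := by
  have htd := hT.t_le
  have hγα : γ * n ≤ α * n := by gcongr; exact hT.gamma_le
  have h1 := card_errors_le_card_unsat A hG hmin (by omega) hy (hx.trans hγα)
  have hc : (0 : ℝ) < c := by exact_mod_cast hT.c_pos
  rw [h, card_empty, Nat.cast_zero, mul_zero, ← mul_assoc] at h1
  have h2 : ((errors x y).card : ℝ) ≤ 0 :=
    nonpos_of_mul_nonpos_right h1 (mul_pos (by linarith [hT.delta_gt]) hc)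
  have h3 : (errors x y).card = 0 := by exact_mod_cast le_antisymm h2 (by positivity)
  rw [card_errors, hammingDist_eq_zero] at h3
  exact h3

end Rounds

/-! ### Reasoning about programs -/

theorem Memory.set_same (s : Memory) (a : ArrayName) (i v : ℕ) :
    s.set a i v a = Function.update (s a) i v := by
  simp [Memory.set]

theorem Memory.set_of_ne (s : Memory) {a b : ArrayName} (h : b ≠ a) (i v : ℕ) :
    s.set a i v b = s b := by
  simp [Memory.set, h]

/-- Programs without loops. -/
def Prog.LoopFree : Prog → Prop
  | .skip => True
  | .write _ _ _ => True
  | .seq p q => p.LoopFree ∧ q.LoopFree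
  | .ifLe _ _ p q => p.LoopFree ∧ q.LoopFree
  | .whileLe _ _ _ => False

/-- The final memory of a loop-free program. -/
def Prog.eval : Prog → Memory → Memory
  | .skip, s => s
  | .write a i e, s => s.set a (i.value s) (e.value s)
  | .seq p q, s => q.eval (p.eval s)
  | .ifLe e f p q, s => if e.value s ≤ f.value s then p.eval s else q.eval s
  | .whileLe _ _ _, s => s

/-- A bound for the running time of a loop-free program. -/
def Prog.bound : Prog → ℕ
  | .skip => 1
  | .write _ i e => i.cost + e.cost + 1
  | .seq p q => p.bound + q.bound
  | .ifLe e f p q => e.cost + f.cost + 1 + (p.bound + q.bound)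
  | .whileLe _ _ _ => 0

/-- The program contains an instruction that writes to the array `a`. -/
def Prog.Writes : Prog → ArrayName → Prop
  | .skip, _ => False
  | .write b _ _, a => a = b
  | .seq p q, a => p.Writes a ∨ q.Writes a
  | .ifLe _ _ p q, a => p.Writes a ∨ q.Writes a
  | .whileLe _ _ p, a => p.Writes a

theorem Prog.runs_eval {p : Prog} (h : p.LoopFree) (s : Memory) :
    ∃ t ≤ p.bound, Runs p s t (p.eval s) := by
  induction p generalizing s with
  | skip => exact ⟨1, le_rfl, .skip s⟩
  | write a i e => exact ⟨_, le_rfl, .write s a i e⟩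
  | seq p q ihp ihq =>
    obtain ⟨t, ht, h1⟩ := ihp h.1 s
    obtain ⟨t', ht', h2⟩ := ihq h.2 (p.eval s)
    exact ⟨t + t', Nat.add_le_add ht ht', .seq h1 h2⟩
  | ifLe e f p q ihp ihq =>
    by_cases hc : e.value s ≤ f.value s
    · obtain ⟨t, ht, h1⟩ := ihp h.1 s
      refine ⟨e.cost + f.cost + 1 + t, by simp only [Prog.bound]; omega, ?_⟩
      simp only [Prog.eval, if_pos hc]
      exact .ifLe_pos hc h1
    · obtain ⟨t, ht, h1⟩ := ihq h.2 s
      refine ⟨e.cost + f.cost + 1 + t, by simp only [Prog.bound]; omega, ?_⟩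
      simp only [Prog.eval, if_neg hc]
      exact .ifLe_neg hc h1
  | whileLe => exact h.elim

theorem Runs.frame {p : Prog} {s s' : Memory} {t : ℕ} (h : Runs p s t s') {a : ArrayName}
    (ha : ¬ p.Writes a) : s' a = s a := by
  induction h with
  | skip => rfl
  | write s b i e => exact Memory.set_of_ne s ha _ _
  | seq _ _ ih1 ih2 => rw [ih2 fun h => ha (.inr h), ih1 fun h => ha (.inl h)]
  | ifLe_pos _ _ ih => exact ih fun h => ha (.inl h)
  | ifLe_neg _ _ ih => exact ih fun h => ha (.inr h)
  | while_done => rfl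
  | while_step _ _ _ ih1 ih2 => rw [ih2 ha, ih1 ha]

theorem Prog.eval_frame {p : Prog} (s : Memory) {a : ArrayName} (ha : ¬ p.Writes a) :
    p.eval s a = s a := by
  induction p generalizing s with
  | skip => rfl
  | write b i e => exact Memory.set_of_ne s ha _ _
  | seq p q ihp ihq => simp only [Prog.eval, ihq _ fun h => ha (.inr h), ihp _ fun h => ha (.inl h)]
  | ifLe e f p q ihp ihq =>
    simp only [Prog.eval]
    split_ifs
    · exact ihp _ fun h => ha (.inl h)
    · exact ihq _ fun h => ha (.inr h)
  | whileLe => rfl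

/-- Started in `s`, the program halts after at most `T` steps in a memory satisfying `Q`. -/
def Term (p : Prog) (s : Memory) (T : ℕ) (Q : Memory → Prop) : Prop :=
  ∃ t s', Runs p s t s' ∧ t ≤ T ∧ Q s'

theorem Term.mono {p : Prog} {s : Memory} {T T' : ℕ} {Q Q' : Memory → Prop} (h : Term p s T Q)
    (hT : T ≤ T') (hQ : ∀ s', Q s' → Q' s') : Term p s T' Q' := by
  obtain ⟨t, s', h1, h2, h3⟩ := h
  exact ⟨t, s', h1, h2.trans hT, hQ _ h3⟩

theorem Term.frame {p : Prog} {s : Memory} {T : ℕ} {Q : Memory → Prop} (h : Term p s T Q) :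
    Term p s T fun s' => Q s' ∧ ∀ a, ¬ p.Writes a → s' a = s a := by
  obtain ⟨t, s', h1, h2, h3⟩ := h
  exact ⟨t, s', h1, h2, h3, fun _ ha => h1.frame ha⟩

theorem Term.of_loopFree {p : Prog} {s : Memory} {Q : Memory → Prop} (hp : p.LoopFree)
    (h : Q (p.eval s)) : Term p s p.bound Q := by
  obtain ⟨t, ht, h1⟩ := Prog.runs_eval hp s
  exact ⟨t, _, h1, ht, h⟩

theorem Term.seq {p q : Prog} {s : Memory} {T T' : ℕ} {Q R : Memory → Prop}
    (h : Term p s T R) (h' : ∀ s', R s' → Term q s' T' Q) : Term (.seq p q) s (T + T') Q := by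
  obtain ⟨t, s', h1, h2, h3⟩ := h
  obtain ⟨t', s'', h1', h2', h3'⟩ := h' s' h3
  exact ⟨t + t', s'', .seq h1 h1', Nat.add_le_add h2 h2', h3'⟩

theorem Term.seq_eval {p q : Prog} {s : Memory} {T : ℕ} {Q : Memory → Prop} (hp : p.LoopFree)
    (h : Term q (p.eval s) T Q) : Term (.seq p q) s (p.bound + T) Q :=
  (Term.of_loopFree (Q := fun s' => s' = p.eval s) hp rfl).seq fun _ hs => hs ▸ h

theorem Term.ifLe {e f : Expr} {p q : Prog} {s : Memory} {T : ℕ} {Q : Memory → Prop}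
    (h1 : e.value s ≤ f.value s → Term p s T Q) (h2 : ¬ e.value s ≤ f.value s → Term q s T Q) :
    Term (.ifLe e f p q) s (e.cost + f.cost + 1 + T) Q := by
  by_cases hc : e.value s ≤ f.value s
  · obtain ⟨t, s', h3, h4, h5⟩ := h1 hc
    exact ⟨_, s', .ifLe_pos hc h3, by omega, h5⟩
  · obtain ⟨t, s', h3, h4, h5⟩ := h2 hc
    exact ⟨_, s', .ifLe_neg hc h3, by omega, h5⟩

theorem Term.while_done {e f : Expr} {p : Prog} {s : Memory} {T : ℕ} {Q : Memory → Prop}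
    (hc : ¬ e.value s ≤ f.value s) (hT : e.cost + f.cost + 1 ≤ T) (h : Q s) :
    Term (.whileLe e f p) s T Q :=
  ⟨_, s, .while_done hc, hT, h⟩

theorem Term.while_step {e f : Expr} {p : Prog} {s : Memory} {T T' : ℕ} {Q R : Memory → Prop}
    (hc : e.value s ≤ f.value s) (h : Term p s T R)
    (h' : ∀ s', R s' → Term (.whileLe e f p) s' T' Q) :
    Term (.whileLe e f p) s (e.cost + f.cost + 1 + T + T') Q := by
  obtain ⟨t, s', h1, h2, h3⟩ := h
  obtain ⟨t', s'', h1', h2', h3'⟩ := h' s' h3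
  exact ⟨_, s'', .while_step hc h1 h1', by omega, h3'⟩

/-- A loop with a known number `N` of iterations. -/
theorem Term.while_count {e f : Expr} {p : Prog} {T N : ℕ} (I : ℕ → Memory → Prop)
    (hstep : ∀ k < N, ∀ s, I k s → e.value s ≤ f.value s ∧ Term p s T (I (k + 1)))
    (hdone : ∀ s, I N s → ¬ e.value s ≤ f.value s) {s : Memory} (h : I 0 s) :
    Term (.whileLe e f p) s ((N + 1) * (e.cost + f.cost + 1 + T)) (I N) := by
  have key : ∀ m k, k + m = N → ∀ s, I k s →
      Term (.whileLe e f p) s ((m + 1) * (e.cost + f.cost + 1 + T)) (I N) := by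
    intro m
    induction m with
    | zero =>
      rintro k rfl s hs
      exact Term.while_done (hdone s hs) (by simp) hs
    | succ m ih =>
      intro k hk s hs
      obtain ⟨h1, h2⟩ := hstep k (by omega) s hs
      refine (Term.while_step h1 h2 fun s' hs' => ih (k + 1) (by omega) s' hs').mono ?_
        fun _ h => h
      exact le_of_eq (by ring)
  exact key N 0 (by omega) s h

/-! ### Arrays and expressions of the decoder -/

/-- The violated constraints, in cells `1, 2, …`. -/
abbrev listA : ArrayName := .work 0
/-- The position of a constraint in `listA`, or `0`. -/
abbrev posA : ArrayName := .work 1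
/-- The number of votes for a variable. -/
abbrev cntA : ArrayName := .work 2
/-- The variables flipped since the start of the current attempt. -/
abbrev stackA : ArrayName := .work 3
/-- The number of violated constraints. -/
abbrev lenA : ArrayName := .work 4
/-- A fixed multiple of the number of violated constraints. -/
abbrev scaledA : ArrayName := .work 5
/-- The height of the stack. -/
abbrev topA : ArrayName := .work 6
/-- The current constraint. -/
abbrev conA : ArrayName := .work 7
/-- The current variable. -/
abbrev varA : ArrayName := .work 8
/-- A loop counter. -/
abbrev idxA : ArrayName := .work 9
/-- The number of violated constraints at the start of the round. -/
abbrev markA : ArrayName := .work 10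
/-- Whether the current round has succeeded. -/
abbrev doneA : ArrayName := .work 11
/-- Whether the current attempt has failed. -/
abbrev badA : ArrayName := .work 12
/-- Whether to go on. -/
abbrev goA : ArrayName := .work 13
/-- The bound for the multiple of the number of violated constraints. -/
abbrev limitA : ArrayName := .work 14
/-- The number of variables on the stack that have been flipped. -/
abbrev baseA : ArrayName := .work 15

/-- The content of cell `0` of an array. -/
abbrev Expr.var (a : ArrayName) : Expr := .read a (.const 0)

/-- Assignment to cell `0` of an array. -/
abbrev Prog.assign (a : ArrayName) (e : Expr) : Prog := .write a (.const 0) e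

/-- Adding a constant. -/
def Expr.plus (e : Expr) : ℕ → Expr
  | 0 => e
  | k + 1 => .succ (e.plus k)

/-- Subtracting a constant. -/
def Expr.minus (e : Expr) : ℕ → Expr
  | 0 => e
  | k + 1 => .pred (e.minus k)

theorem Expr.value_plus (s : Memory) (e : Expr) (k : ℕ) : (e.plus k).value s = e.value s + k := by
  induction k with
  | zero => rfl
  | succ k ih => simp only [Expr.plus, Expr.value, ih, add_assoc]

theorem Expr.value_minus (s : Memory) (e : Expr) (k : ℕ) :
    (e.minus k).value s = e.value s - k := by
  induction k with
  | zero => rfl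
  | succ k ih => simp only [Expr.minus, Expr.value, ih]; omega

/-! ### The list of violated constraints -/

/-- The memory represents the set `S` of constraints. -/
structure SetRep {r : ℕ} (B : ℕ) (s : Memory) (S : Finset (Fin r)) : Prop where
  len : s lenA 0 = S.card
  scaled : s scaledA 0 = B * S.card
  pos_mem : ∀ u ∈ S, 1 ≤ s posA u ∧ s posA u ≤ S.card ∧ s listA (s posA u) = u
  pos_notMem : ∀ u ∉ S, s posA (u : Fin r) = 0
  list : ∀ i, 1 ≤ i → i ≤ S.card → ∃ u ∈ S, s listA i = u ∧ s posA u = i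

theorem SetRep.congr {r B : ℕ} {s s' : Memory} {S : Finset (Fin r)} (h : SetRep B s S)
    (h1 : s' lenA = s lenA) (h2 : s' scaledA = s scaledA) (h3 : s' posA = s posA)
    (h4 : s' listA = s listA) : SetRep B s' S := by
  constructor
  · rw [h1, h.len]
  · rw [h2, h.scaled]
  · rw [h3, h4]; exact h.pos_mem
  · rw [h3]; exact h.pos_notMem
  · rw [h3, h4]; exact h.list

theorem SetRep.pos_pos_iff {r B : ℕ} {s : Memory} {S : Finset (Fin r)} (h : SetRep B s S)
    (u : Fin r) : 1 ≤ s posA u ↔ u ∈ S := by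
  constructor
  · intro h1
    by_contra h2
    rw [h.pos_notMem u h2] at h1
    omega
  · exact fun h1 => (h.pos_mem u h1).1

/-- Insert the current constraint into the list. -/
def insertProg (B : ℕ) : Prog :=
  .ifLe (.const 1) (.read posA (.var conA)) .skip
    (.seq (.assign lenA (.succ (.var lenA)))
      (.seq (.assign scaledA ((Expr.var scaledA).plus B))
        (.seq (.write listA (.var lenA) (.var conA))
          (.write posA (.var conA) (.var lenA)))))

/-- Remove the current constraint from the list, moving the last one to its place. -/
def removeProg (B : ℕ) : Prog :=
  .ifLe (.const 1) (.read posA (.var conA))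
    (.seq (.write listA (.read posA (.var conA)) (.read listA (.var lenA)))
      (.seq (.write posA (.read listA (.var lenA)) (.read posA (.var conA)))
        (.seq (.write posA (.var conA) (.const 0))
          (.seq (.assign scaledA ((Expr.var scaledA).minus B))
            (.assign lenA (.pred (.var lenA)))))))
    .skip

theorem insertProg_spec {r B : ℕ} {s : Memory} {S : Finset (Fin r)} (h : SetRep B s S) {u : Fin r}
    (hu : s conA 0 = u) : SetRep B ((insertProg B).eval s) (insert u S) := by
  by_cases huS : u ∈ S
  · have h1 := (h.pos_pos_iff u).2 huS
    simpa [insertProg, Prog.eval, Expr.value, hu, h1, huS] using h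
  have h1 : s posA u = 0 := h.pos_notMem u huS
  have hcard : (insert u S).card = S.card + 1 := card_insert_of_notMem huS
  set s' := (insertProg B).eval s with hs'
  simp only [insertProg, Prog.eval, Expr.value, hu, h1] at hs'
  have elen : s' lenA 0 = S.card + 1 := by
    simp [hs', Memory.set_same, Memory.set_of_ne, h.len]
  have escaled : s' scaledA 0 = B * S.card + B := by
    simp [hs', Memory.set_same, Memory.set_of_ne, h.scaled, Expr.value_plus, Expr.value]
  have elist : s' listA = Function.update (s listA) (S.card + 1) u := by
    simp [hs', Memory.set_same, Memory.set_of_ne, h.len, hu]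
  have epos : s' posA = Function.update (s posA) u (S.card + 1) := by
    simp [hs', Memory.set_same, Memory.set_of_ne, h.len, hu]
  clear_value s'
  constructor
  · rw [elen, hcard]
  · rw [escaled, hcard]; ring
  · intro w hw
    rw [epos, elist, hcard]
    by_cases hwu : w = u
    · subst hwu; simp
    · have hwS := (mem_insert.1 hw).resolve_left hwu
      obtain ⟨g1, g2, g3⟩ := h.pos_mem w hwS
      rw [Function.update_of_ne (by simpa [Fin.ext_iff] using hwu),
        Function.update_of_ne (by omega)]
      exact ⟨g1, by omega, g3⟩
  · intro w hw
    rw [mem_insert, not_or] at hw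
    rw [epos, Function.update_of_ne (by simpa [Fin.ext_iff] using hw.1)]
    exact h.pos_notMem w hw.2
  · intro i hi hi'
    rw [epos, elist]
    by_cases hi2 : i = S.card + 1
    · subst hi2
      exact ⟨u, mem_insert_self _ _, by simp, by simp⟩
    · obtain ⟨w, hw, g1, g2⟩ := h.list i hi (by omega)
      have hwu : w ≠ u := by rintro rfl; exact huS hw
      refine ⟨w, mem_insert_of_mem hw, ?_, ?_⟩
      · rw [Function.update_of_ne hi2, g1]
      · rw [Function.update_of_ne (by simpa [Fin.ext_iff] using hwu), g2]

/-- The order of the writes covers the case that the removed constraint is itself the last one: its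
position is first rewritten with its old value and only then set to `0`. -/
theorem removeProg_spec {r B : ℕ} {s : Memory} {S : Finset (Fin r)} (h : SetRep B s S) {u : Fin r}
    (hu : s conA 0 = u) : SetRep B ((removeProg B).eval s) (S.erase u) := by
  by_cases huS : u ∈ S
  swap
  · have h1 := h.pos_notMem u huS
    simpa [removeProg, Prog.eval, Expr.value, hu, h1, huS] using h
  obtain ⟨p1, p2, p3⟩ := h.pos_mem u huS
  have hcard : (S.erase u).card = S.card - 1 := card_erase_of_mem huS
  obtain ⟨l, hl, l1, l2⟩ := h.list S.card (by omega) le_rfl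
  set p := s posA u with hp
  set s' := (removeProg B).eval s with hs'
  simp only [removeProg, Prog.eval, Expr.value, hu, ← hp, p1, if_true] at hs'
  have elen : s' lenA 0 = S.card - 1 := by
    simp [hs', Memory.set_same, Memory.set_of_ne, h.len]
  have escaled : s' scaledA 0 = B * S.card - B := by
    simp [hs', Memory.set_same, Memory.set_of_ne, h.scaled, Expr.value_minus, Expr.value]
  have elist : s' listA = Function.update (s listA) p l := by
    simp [hs', Memory.set_same, Memory.set_of_ne, h.len, l1]
  have epos : s' posA = Function.update (Function.update (s posA) l p) u 0 := by
    -- The second write reads the last cell after the first has changed cell `p`; if the two cells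
    -- coincide, the content is still `l`.
    have : Function.update (s listA) p (l : ℕ) S.card = l := by
      rw [Function.update_apply]
      split_ifs
      · rfl
      · exact l1
    simp [hs', Memory.set_same, Memory.set_of_ne, h.len, l1, hu, this, ← hp]
  clear_value s'
  have inj : ∀ w ∈ S, w ≠ u → s posA w ≠ p := by
    intro w hw hwu he
    have := (h.pos_mem w hw).2.2
    rw [he, p3] at this
    exact hwu (Fin.ext this.symm)
  constructor
  · rw [elen, hcard]
  · rw [escaled, hcard, Nat.mul_sub, mul_one]
  · intro w hw
    obtain ⟨hwu, hwS⟩ := mem_erase.1 hw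
    obtain ⟨g1, g2, g3⟩ := h.pos_mem w hwS
    rw [epos, elist, hcard, Function.update_of_ne (by simpa [Fin.ext_iff] using hwu)]
    by_cases hwl : w = l
    · subst hwl
      have := inj w hwS hwu
      rw [Function.update_self, Function.update_self]
      exact ⟨p1, by omega, rfl⟩
    · have hne : s posA w ≠ S.card := by
        intro he
        rw [he, l1] at g3
        exact hwl (Fin.ext g3.symm)
      rw [Function.update_of_ne (by simpa [Fin.ext_iff] using hwl),
        Function.update_of_ne (inj w hwS hwu)]
      exact ⟨g1, by omega, g3⟩
  · intro w hw
    rw [epos]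
    by_cases hwu : w = u
    · subst hwu; simp
    · have hwS : w ∉ S := fun h' => hw (mem_erase.2 ⟨hwu, h'⟩)
      have hwl : w ≠ l := by rintro rfl; exact hwS hl
      rw [Function.update_of_ne (by simpa [Fin.ext_iff] using hwu),
        Function.update_of_ne (by simpa [Fin.ext_iff] using hwl)]
      exact h.pos_notMem w hwS
  · intro i hi hi'
    rw [epos, elist]
    by_cases hip : i = p
    · subst hip
      have hlu : l ≠ u := by
        rintro rfl
        omega
      refine ⟨l, mem_erase.2 ⟨hlu, hl⟩, by simp, ?_⟩
      rw [Function.update_of_ne (by simpa [Fin.ext_iff] using hlu), Function.update_self]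
    · obtain ⟨w, hw, g1, g2⟩ := h.list i hi (by omega)
      have hwu : w ≠ u := by rintro rfl; exact hip g2.symm
      have hwl : w ≠ l := by rintro rfl; omega
      refine ⟨w, mem_erase.2 ⟨hwu, hw⟩, ?_, ?_⟩
      · rw [Function.update_of_ne hip, g1]
      · rw [Function.update_of_ne (by simpa [Fin.ext_iff] using hwu),
          Function.update_of_ne (by simpa [Fin.ext_iff] using hwl), g2]

/-! ### Decision trees over the bits seen by a constraint -/

/-- Branch over the bits of the first `k` neighbours of the current constraint. -/
def branch : (k : ℕ) → ((Fin k → ZMod 2) → Prog) → Prog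
  | 0, P => P Fin.elim0
  | k + 1, P => .ifLe (.const 1) (.read .word (.read (.right k) (.var conA)))
      (branch k fun w => P (Fin.snoc (α := fun _ => ZMod 2) w 1))
      (branch k fun w => P (Fin.snoc (α := fun _ => ZMod 2) w 0))

/-- The bits of the first `k` neighbours of the current constraint. -/
def seenBits (s : Memory) (k : ℕ) : Fin k → ZMod 2 :=
  fun j => if 1 ≤ s .word (s (.right j) (s conA 0)) then 1 else 0

theorem snoc_seenBits (s : Memory) (k : ℕ) :
    Fin.snoc (α := fun _ => ZMod 2) (seenBits s k)
      (if 1 ≤ s .word (s (.right k) (s conA 0)) then 1 else 0) = seenBits s (k + 1) := by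
  funext j
  induction j using Fin.lastCases with
  | last => simp [seenBits]
  | cast j => simp [seenBits]

/-- The tests change no memory, so the leaf runs in the original state. As the leaf may depend on
all bits, any function of a view, such as membership in `C₀` or the chosen vote, is hard-wired into
the program at a cost depending on `d` but not on `n`. -/
theorem branch_eval (k : ℕ) (P : (Fin k → ZMod 2) → Prog) (s : Memory) :
    (branch k P).eval s = (P (seenBits s k)).eval s := by
  induction k with
  | zero => simp only [branch]; congr; funext j; exact j.elim0
  | succ k ih =>
    simp only [branch, Prog.eval, Expr.value, ih]
    rw [← snoc_seenBits]
    split_ifs <;> rfl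

theorem branch_loopFree {k : ℕ} {P : (Fin k → ZMod 2) → Prog} (h : ∀ w, (P w).LoopFree) :
    (branch k P).LoopFree := by
  induction k with
  | zero => exact h _
  | succ k ih => exact ⟨ih fun w => h _, ih fun w => h _⟩

theorem branch_writes {k : ℕ} {P : (Fin k → ZMod 2) → Prog} {a : ArrayName}
    (h : ∀ w, ¬ (P w).Writes a) : ¬ (branch k P).Writes a := by
  induction k with
  | zero => exact h _
  | succ k ih =>
    rintro (h' | h')
    · exact ih (fun w => h _) h'
    · exact ih (fun w => h _) h'

/-! ### Maintaining the word, the violated constraints and the stack. -/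

section Pieces

variable {n r c d : ℕ} {G : SimpleGraph (Fin n ⊕ Fin r)} (A : AdjacencyLists G c d)
  (C₀ : Submodule (ZMod 2) (Fin d → ZMod 2))

/-- The memory contains the graph and the word `x`. -/
structure InputRep (s : Memory) (x : Fin n → ZMod 2) : Prop where
  size_zero : s .size 0 = n
  size_one : s .size 1 = r
  right : ∀ (u : Fin r) (j : Fin d), s (.right j) u = A.right u j
  left : ∀ (v : Fin n) (i : Fin c), s (.left i) v = A.left v i
  word : ∀ v : Fin n, s .word v = (x v).val

/-- The arrays that carry the graph. -/
def ArrayName.IsGraph : ArrayName → Prop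
  | .size => True
  | .right _ => True
  | .left _ => True
  | _ => False

variable {A} in
theorem InputRep.congr {s s' : Memory} {x : Fin n → ZMod 2} (h : InputRep A s x)
    (h1 : ∀ a : ArrayName, a.IsGraph → s' a = s a) (h2 : s' .word = s .word) :
    InputRep A s' x := by
  constructor
  · rw [h1 .size trivial, h.size_zero]
  · rw [h1 .size trivial, h.size_one]
  · intro u j; rw [h1 (.right j) trivial, h.right]
  · intro v i; rw [h1 (.left i) trivial, h.left]
  · rw [h2]; exact h.word

theorem one_le_val_iff (b : ZMod 2) : 1 ≤ b.val ↔ b = 1 := by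
  revert b; decide

theorem seenBits_eq_view {s : Memory} {x : Fin n → ZMod 2} (h : InputRep A s x) {u : Fin r}
    (hu : s conA 0 = u) : seenBits s d = view A x u := by
  funext j
  have h01 : ∀ b : ZMod 2, (if b = 1 then 1 else 0) = b := by decide
  simp only [seenBits, view, hu, h.right, h.word, one_le_val_iff, h01]

open Classical in
/-- Recompute whether the current constraint is violated. -/
noncomputable def updateProg (B : ℕ) : Prog :=
  branch d fun w => if w ∈ C₀ then removeProg B else insertProg B

theorem updateProg_loopFree (B : ℕ) : (updateProg C₀ B).LoopFree := by
  refine branch_loopFree fun w => ?_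
  split_ifs <;> simp [removeProg, insertProg, Prog.LoopFree]

theorem updateProg_writes {B : ℕ} {a : ArrayName}
    (h : a ∉ [listA, posA, lenA, scaledA]) : ¬ (updateProg C₀ B).Writes a := by
  simp only [List.mem_cons, List.not_mem_nil, or_false, not_or] at h
  refine branch_writes fun w => ?_
  split_ifs <;> simp [removeProg, insertProg, Prog.Writes, h]

/-- `S` is arbitrary because the list is out of date when this is used: during initialisation, and
between the updates of the neighbours of a flipped variable. -/
theorem updateProg_spec {B : ℕ} {s : Memory} {x : Fin n → ZMod 2} (h : InputRep A s x)
    {S : Finset (Fin r)} (hS : SetRep B s S) {u : Fin r} (hu : s conA 0 = u) :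
    ∃ S', SetRep B ((updateProg C₀ B).eval s) S' ∧
      ∀ w, w ∈ S' ↔ if w = u then w ∈ unsat A C₀ x else w ∈ S := by
  classical
  rw [updateProg, branch_eval, seenBits_eq_view A h hu]
  split_ifs with hC
  · refine ⟨_, removeProg_spec hS hu, fun w => ?_⟩
    split_ifs with hw
    · subst hw; simp [mem_unsat, hC]
    · simp [hw]
  · refine ⟨_, insertProg_spec hS hu, fun w => ?_⟩
    split_ifs with hw
    · subst hw; simp [mem_unsat, hC]
    · simp [hw]

/-- Recompute the status of the first `k` neighbours of the current variable. -/
noncomputable def updateNeighbours (B : ℕ) : ℕ → Prog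
  | 0 => .skip
  | k + 1 => .seq (updateNeighbours B k)
      (.seq (.assign conA (.read (.left k) (.var varA))) (updateProg C₀ B))

theorem updateNeighbours_loopFree (B k : ℕ) : (updateNeighbours C₀ B k).LoopFree := by
  induction k with
  | zero => trivial
  | succ k ih => exact ⟨ih, trivial, updateProg_loopFree C₀ B⟩

theorem updateNeighbours_writes {B k : ℕ} {a : ArrayName}
    (h : a ∉ [listA, posA, lenA, scaledA, conA]) : ¬ (updateNeighbours C₀ B k).Writes a := by
  simp only [List.mem_cons, List.not_mem_nil, or_false, not_or] at h
  induction k with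
  | zero => exact fun h => h
  | succ k ih =>
    rintro (h' | h' | h')
    · exact ih h'
    · exact h.2.2.2.2 h'
    · exact updateProg_writes C₀ (by simp [h]) h'

theorem isGraph_ne_work {a : ArrayName} (h : a.IsGraph) (k : ℕ) : a ≠ .work k := by
  rintro rfl; exact h

theorem updateNeighbours_spec {B k : ℕ} (hk : k ≤ c) {s : Memory} {x : Fin n → ZMod 2}
    (h : InputRep A s x) {S : Finset (Fin r)} (hS : SetRep B s S) {v : Fin n}
    (hv : s varA 0 = v) :
    ∃ S', SetRep B ((updateNeighbours C₀ B k).eval s) S' ∧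
      ∀ w, w ∈ S' ↔ if ∃ i : Fin c, i < k ∧ A.left v i = w then w ∈ unsat A C₀ x else w ∈ S := by
  induction k with
  | zero => exact ⟨S, hS, by simp⟩
  | succ k ih =>
    obtain ⟨S', hS', hmem⟩ := ih (by omega)
    set s₁ := (updateNeighbours C₀ B k).eval s with hs₁
    have hf : ∀ a : ArrayName, a ∉ [listA, posA, lenA, scaledA, conA] → s₁ a = s a := fun a ha =>
      Prog.eval_frame s (updateNeighbours_writes C₀ ha)
    set s₂ := (Prog.assign conA (.read (.left k) (.var varA))).eval s₁ with hs₂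
    have hg : ∀ a : ArrayName, a ≠ conA → s₂ a = s₁ a := fun a ha => Memory.set_of_ne _ ha _ _
    have hI : InputRep A s₂ x := by
      refine h.congr (fun a ha => ?_) ?_
      · rw [hg _ (isGraph_ne_work ha _), hf]
        simp [isGraph_ne_work ha]
      · rw [hg _ (by simp), hf _ (by simp)]
    have hS₂ : SetRep B s₂ S' :=
      hS'.congr (hg _ (by simp)) (hg _ (by simp)) (hg _ (by simp)) (hg _ (by simp))
    have hcon : s₂ conA 0 = A.left v ⟨k, hk⟩ := by
      have h1 : s₁ varA 0 = v := by rw [hf _ (by simp), hv]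
      have h2 : s₁ (.left k) v = A.left v ⟨k, hk⟩ := by
        rw [hf _ (by simp)]; exact h.left v ⟨k, hk⟩
      simp [hs₂, Prog.eval, Memory.set_same, Expr.value, h1, h2]
    obtain ⟨S'', hS'', hmem'⟩ := updateProg_spec A C₀ hI hS₂ hcon
    refine ⟨S'', hS'', fun w => ?_⟩
    rw [hmem', hmem]
    have hex : (∃ i : Fin c, (i : ℕ) < k + 1 ∧ A.left v i = w) ↔
        (w = A.left v ⟨k, hk⟩ ∨ ∃ i : Fin c, (i : ℕ) < k ∧ A.left v i = w) := by
      constructor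
      · rintro ⟨i, hi, rfl⟩
        rcases Nat.lt_succ_iff_lt_or_eq.1 hi with hi | hi
        · exact .inr ⟨i, hi, rfl⟩
        · left; congr; exact Fin.ext hi
      · rintro (rfl | ⟨i, hi, rfl⟩)
        · exact ⟨_, Nat.lt_succ_self k, rfl⟩
        · exact ⟨i, by omega, rfl⟩
    rw [if_congr hex rfl rfl]
    by_cases h1 : w = A.left v ⟨k, hk⟩
    · simp [h1]
    · simp [h1]

/-- Flip the current variable. -/
noncomputable def flipProg (c B : ℕ) : Prog :=
  .seq (.ifLe (.const 1) (.read .word (.var varA)) (.write .word (.var varA) (.const 0))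
    (.write .word (.var varA) (.const 1))) (updateNeighbours C₀ B c)

theorem flipProg_loopFree (B : ℕ) : (flipProg C₀ c B).LoopFree :=
  ⟨⟨trivial, trivial⟩, updateNeighbours_loopFree C₀ B c⟩

theorem flipProg_writes {B : ℕ} {a : ArrayName}
    (h : a ∉ [listA, posA, lenA, scaledA, conA, .word]) : ¬ (flipProg C₀ c B).Writes a := by
  simp only [List.mem_cons, List.not_mem_nil, or_false, not_or] at h
  rintro ((h' | h') | h')
  · exact h.2.2.2.2.2 h'
  · exact h.2.2.2.2.2 h'
  · exact updateNeighbours_writes C₀ (by simp [h]) h'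

theorem flipProg_spec {B : ℕ} {s : Memory} {x : Fin n → ZMod 2}
    (h : InputRep A s x) (hS : SetRep B s (unsat A C₀ x)) {v : Fin n} (hv : s varA 0 = v) :
    InputRep A ((flipProg C₀ c B).eval s) (Function.update x v (x v + 1)) ∧
      SetRep B ((flipProg C₀ c B).eval s) (unsat A C₀ (Function.update x v (x v + 1))) := by
  set x' := Function.update x v (x v + 1) with hx'
  set s₁ := (Prog.ifLe (.const 1) (.read .word (.var varA))
    (.write .word (.var varA) (.const 0)) (.write .word (.var varA) (.const 1))).eval s with hs₁
  have hg : ∀ a : ArrayName, a ≠ .word → s₁ a = s a := fun a ha =>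
    Prog.eval_frame s (by simp [Prog.Writes, ha])
  have hw : s₁ .word = Function.update (s .word) v (x v + 1).val := by
    have h01 : ∀ b : ZMod 2, (b + 1).val = if b = 1 then 0 else 1 := by decide
    simp only [hs₁, Prog.eval, Expr.value, hv, h.word, one_le_val_iff, h01]
    split_ifs <;> simp [Memory.set_same]
  have hI : InputRep A s₁ x' := by
    constructor
    · rw [hg _ (by simp), h.size_zero]
    · rw [hg _ (by simp), h.size_one]
    · intro u j; rw [hg _ (by simp), h.right]
    · intro u j; rw [hg _ (by simp), h.left]
    · intro w
      rw [hw, hx']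
      by_cases hwv : w = v
      · subst hwv; simp
      · rw [Function.update_of_ne hwv, Function.update_of_ne (by simpa [Fin.ext_iff] using hwv),
          h.word]
  have hS₁ : SetRep B s₁ (unsat A C₀ x) :=
    hS.congr (hg _ (by simp)) (hg _ (by simp)) (hg _ (by simp)) (hg _ (by simp))
  obtain ⟨S', hS', hmem⟩ := updateNeighbours_spec A C₀ le_rfl hI hS₁ (v := v)
    (by rw [hg _ (by simp), hv])
  -- All neighbours of `v` have been recomputed, and any other constraint sees the same bits as
  -- before.
  have heq : S' = unsat A C₀ x' := by
    ext w
    rw [hmem]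
    split_ifs with hex
    · rfl
    · rw [mem_unsat, mem_unsat]
      have : view A x w = view A x' w := by
        funext j
        have : A.right w j ≠ v := by
          rintro hj
          obtain ⟨i, hi⟩ := (A.exists_left_iff_exists_right w v).2 ⟨j, hj⟩
          exact hex ⟨i, i.2, hi⟩
        simp [view, hx', this]
      rw [this]
  refine ⟨hI.congr (fun a ha => ?_) ?_, heq ▸ hS'⟩
  · exact Prog.eval_frame s₁ (updateNeighbours_writes C₀ (by simp [isGraph_ne_work ha]))
  · exact Prog.eval_frame s₁ (updateNeighbours_writes C₀ (by simp))

/-- The memory contains the stack `l`. -/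
structure StackRep (s : Memory) (l : List (Fin n)) : Prop where
  top : s topA 0 = l.length
  stack : ∀ i (hi : i < l.length), s stackA i = l[i]

theorem StackRep.congr {s s' : Memory} {l : List (Fin n)} (h : StackRep s l)
    (h1 : s' topA = s topA) (h2 : s' stackA = s stackA) : StackRep s' l :=
  ⟨by rw [h1, h.top], by rw [h2]; exact h.stack⟩

theorem StackRep.push {s s' : Memory} {l : List (Fin n)} (h : StackRep s l) (v : Fin n)
    (h1 : s' topA 0 = s topA 0 + 1) (h2 : s' stackA = Function.update (s stackA) (s topA 0) v) :
    StackRep s' (l ++ [v]) := by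
  constructor
  · rw [h1, h.top]; simp
  · intro i hi
    rw [h2, h.top]
    by_cases hil : i = l.length
    · subst hil; simp
    · have hi' : i < l.length := by simp at hi; omega
      rw [Function.update_of_ne hil, h.stack i hi', List.getElem_append_left hi']

end Pieces

/-! ### One flipping step in time proportional to the number of violated constraints. -/

section Step

variable {n r c d : ℕ} {G : SimpleGraph (Fin n ⊕ Fin r)} (A : AdjacencyLists G c d)
  (C₀ : Submodule (ZMod 2) (Fin d → ZMod 2))

/-- Flip the variables in a list, with multiplicities. -/
def shift (x : Fin n → ZMod 2) (l : List (Fin n)) : Fin n → ZMod 2 :=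
  fun v => x v + (l.count v : ZMod 2)

theorem shift_nil (x : Fin n → ZMod 2) : shift x [] = x := by
  funext v; simp [shift]

theorem shift_shift (x : Fin n → ZMod 2) (l l' : List (Fin n)) :
    shift (shift x l) l' = shift x (l ++ l') := by
  funext v; simp [shift, List.count_append, add_assoc]

theorem shift_append_singleton (x : Fin n → ZMod 2) (l : List (Fin n)) (w : Fin n) :
    shift x (l ++ [w]) = Function.update (shift x l) w (shift x l w + 1) := by
  funext v
  by_cases h : v = w
  · subst h; simp [shift, List.count_append, add_assoc]
  · simp [shift, List.count_append, h, Ne.symm h]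

/-- Count a vote for the `j`-th neighbour of the current constraint, and push this neighbour when
it reaches `q` votes. -/
def bumpProg (q j : ℕ) : Prog :=
  .seq (.assign varA (.read (.right j) (.var conA)))
    (.seq (.write cntA (.var varA) (.succ (.read cntA (.var varA))))
      (.ifLe (.read cntA (.var varA)) (.const q)
        (.ifLe (.const q) (.read cntA (.var varA))
          (.seq (.write stackA (.var topA) (.var varA)) (.assign topA (.succ (.var topA))))
          .skip)
        .skip))

theorem bumpProg_writes {q j : ℕ} {a : ArrayName} (h : a ∉ [varA, cntA, stackA, topA]) :
    ¬ (bumpProg q j).Writes a := by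
  simp only [List.mem_cons, List.not_mem_nil, or_false, not_or] at h
  simp [bumpProg, Prog.Writes, h]

theorem bumpProg_cnt {q j : ℕ} {s : Memory} {w : ℕ} (hw : s (.right j) (s conA 0) = w) :
    (bumpProg q j).eval s cntA = Function.update (s cntA) w (s cntA w + 1) := by
  by_cases h1 : s cntA w + 1 ≤ q <;> by_cases h2 : q ≤ s cntA w + 1 <;>
    simp [bumpProg, Prog.eval, Expr.value, Memory.set_same, Memory.set_of_ne, hw, h1, h2]

/-- The push happens when the counter equals `q`, an equality spelled out by two comparisons; a
variable that goes on collecting votes is not pushed again. -/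
theorem bumpProg_stack {q j : ℕ} {s : Memory} {w : Fin n} (hw : s (.right j) (s conA 0) = w)
    {l : List (Fin n)} (h : StackRep s l) :
    StackRep ((bumpProg q j).eval s) (if s cntA w + 1 = q then l ++ [w] else l) := by
  by_cases hq : s cntA w + 1 = q
  · rw [if_pos hq]
    apply h.push
    · simp [bumpProg, Prog.eval, Expr.value, Memory.set_same, Memory.set_of_ne, hw, hq]
    · simp [bumpProg, Prog.eval, Expr.value, Memory.set_same, Memory.set_of_ne, hw, hq]
  · rw [if_neg hq]
    refine h.congr ?_ ?_ <;>
    · by_cases h1 : s cntA w + 1 ≤ q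
      · have h2 : ¬ q ≤ s cntA w + 1 := by omega
        simp [bumpProg, Prog.eval, Expr.value, Memory.set_same, Memory.set_of_ne, hw, h1, h2]
      · simp [bumpProg, Prog.eval, Expr.value, Memory.set_same, Memory.set_of_ne, hw, h1]

/-- Process the vote of one violated constraint. -/
noncomputable def forVote (t : ℕ) (P : ℕ → Prog) : Prog :=
  .seq (.assign conA (.read listA (.var idxA)))
    (.seq (branch d fun w => match message C₀ t w with
        | none => .skip
        | some j => P j)
      (.assign idxA (.succ (.var idxA))))

/-- Process the votes of all violated constraints. -/
noncomputable def forVotes (t : ℕ) (P : ℕ → Prog) : Prog :=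
  .whileLe (.var idxA) (.var lenA) (forVote C₀ t P)

theorem forVote_loopFree {t : ℕ} {P : ℕ → Prog} (h : ∀ j, (P j).LoopFree) :
    (forVote C₀ t P).LoopFree := by
  refine ⟨trivial, branch_loopFree fun w => ?_, trivial⟩
  cases message C₀ t w with
  | none => trivial
  | some j => exact h j

theorem forVote_writes {t : ℕ} {P : ℕ → Prog} {a : ArrayName} (h : ∀ j, ¬ (P j).Writes a)
    (h1 : a ≠ conA) (h2 : a ≠ idxA) : ¬ (forVote C₀ t P).Writes a := by
  rintro (h' | h' | h')
  · exact h1 h'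
  · refine branch_writes (fun w => ?_) h'
    cases message C₀ t w with
    | none => exact fun h => h
    | some j => exact h j
  · exact h2 h'

variable {C₀} in
/-- Processing one vote amounts to running `P j` (if the constraint votes at all) in a memory that
differs from the current one only in the array that holds the current constraint. -/
theorem forVote_eval {t k B : ℕ} {P : ℕ → Prog} {s : Memory} {x : Fin n → ZMod 2}
    (h : InputRep A s x) (hP : ∀ j, ¬ (P j).Writes idxA)
    (hS : SetRep B s (unsat A C₀ x)) (hi : s idxA 0 = k + 1) (hk : k < (unsat A C₀ x).card) :
    ∃ u ∈ unsat A C₀ x, s posA u = k + 1 ∧ ∃ s₁ s₂ : Memory,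
      (∀ a, a ≠ conA → s₁ a = s a) ∧ (∀ a, a ≠ idxA → (forVote C₀ t P).eval s a = s₂ a) ∧
      (forVote C₀ t P).eval s idxA 0 = k + 2 ∧
      ((target A C₀ t x u = none ∧ s₂ = s₁) ∨
        ∃ j : Fin d, target A C₀ t x u = some (A.right u j) ∧
          s₁ (.right j) (s₁ conA 0) = A.right u j ∧ s₂ = (P j).eval s₁) := by
  obtain ⟨u, hu, h1, h2⟩ := hS.list (k + 1) (by omega) (by omega)
  set s₁ := (Prog.assign conA (.read listA (.var idxA))).eval s with hs₁
  have hg : ∀ a : ArrayName, a ≠ conA → s₁ a = s a := fun a ha => Memory.set_of_ne _ ha _ _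
  have hcon : s₁ conA 0 = u := by
    simp [hs₁, Prog.eval, Expr.value, Memory.set_same, hi, h1]
  have hI : InputRep A s₁ x :=
    h.congr (fun a ha => hg a (isGraph_ne_work ha _)) (hg _ (by simp))
  set s₂ := (branch d fun w => match message C₀ t w with
        | none => .skip
        | some j => P j).eval s₁ with hs₂
  have hev : (forVote C₀ t P).eval s = (Prog.assign idxA (.succ (.var idxA))).eval s₂ := rfl
  have hidx : s₂ idxA 0 = k + 1 := by
    have : s₂ idxA = s₁ idxA := by
      refine Prog.eval_frame s₁ (branch_writes fun w => ?_)
      cases message C₀ t w with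
      | none => exact fun h => h
      | some j => exact hP j
    rw [this, hg _ (by simp), hi]
  refine ⟨u, hu, h2, s₁, s₂, hg, fun a ha => ?_, ?_, ?_⟩
  · rw [hev]; exact Memory.set_of_ne _ ha _ _
  · rw [hev]; simp [Prog.eval, Expr.value, Memory.set_same, hidx]
  · rw [branch_eval, seenBits_eq_view A hI hcon] at hs₂
    cases hm : message C₀ t (view A x u) with
    | none =>
      left
      rw [hm] at hs₂
      exact ⟨by simp [target, hm], hs₂⟩
    | some j =>
      right
      rw [hm] at hs₂
      exact ⟨j, by simp [target, hm], by rw [hcon, hI.right], hs₂⟩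

theorem SetRep.eq_of_pos_eq {B : ℕ} {s : Memory} {S : Finset (Fin r)} (h : SetRep B s S)
    {u w : Fin r} (hu : u ∈ S) (hw : w ∈ S) (he : s posA u = s posA w) : u = w := by
  have h1 := (h.pos_mem u hu).2.2
  have h2 := (h.pos_mem w hw).2.2
  rw [he, h2] at h1
  exact Fin.ext h1.symm

/-- Positions of listed constraints are distinct, so passing from `k` to `k + 1` adds `u` alone. -/
theorem card_filter_pos_succ {B : ℕ} {s : Memory} {S : Finset (Fin r)} (h : SetRep B s S)
    {u : Fin r} (hu : u ∈ S) {k : ℕ} (hk : s posA u = k + 1) (p : Fin r → Prop) [DecidablePred p] :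
    (S.filter fun w : Fin r => s posA w ≤ k + 1 ∧ p w).card =
      (S.filter fun w : Fin r => s posA w ≤ k ∧ p w).card + if p u then 1 else 0 := by
  split_ifs with hp
  · rw [← card_insert_of_notMem (a := u)]
    · congr 1
      ext w
      simp only [mem_filter, mem_insert]
      constructor
      · rintro ⟨h1, h2, h3⟩
        by_cases hw : s posA w = k + 1
        · exact .inl (h.eq_of_pos_eq h1 hu (hw.trans hk.symm))
        · exact .inr ⟨h1, by omega, h3⟩
      · rintro (rfl | ⟨h1, h2, h3⟩)
        · exact ⟨hu, hk.le, hp⟩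
        · exact ⟨h1, by omega, h3⟩
    · simp [hk]
  · congr 1
    ext w
    simp only [mem_filter]
    constructor
    · rintro ⟨h1, h2, h3⟩
      have : s posA w ≠ k + 1 := by
        intro hw
        rw [h.eq_of_pos_eq h1 hu (hw.trans hk.symm)] at h3
        exact hp h3
      exact ⟨h1, by omega, h3⟩
    · rintro ⟨h1, h2, h3⟩
      exact ⟨h1, by omega, h3⟩

/-- The memory represents the word, its violated constraints and the stack. -/
structure Core (B : ℕ) (s : Memory) (x : Fin n → ZMod 2) (stk : List (Fin n)) : Prop where
  input : InputRep A s x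
  list : SetRep B s (unsat A C₀ x)
  stack : StackRep s stk

variable {A C₀} in
theorem Core.congr {B : ℕ} {s s' : Memory} {x : Fin n → ZMod 2} {stk : List (Fin n)}
    (h : Core A C₀ B s x stk) (h1 : ∀ a : ArrayName, a.IsGraph → s' a = s a)
    (h2 : ∀ a ∈ [.word, lenA, scaledA, posA, listA, topA, stackA], s' a = s a) :
    Core A C₀ B s' x stk :=
  ⟨h.input.congr h1 (h2 _ (by simp)),
    h.list.congr (h2 _ (by simp)) (h2 _ (by simp)) (h2 _ (by simp)) (h2 _ (by simp)),
    h.stack.congr (h2 _ (by simp)) (h2 _ (by simp))⟩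

/-- The state of the vote count after `k` votes. -/
structure Voting (t B q : ℕ) (x : Fin n → ZMod 2) (stk : List (Fin n)) (k : ℕ) (s : Memory) :
    Prop where
  idx : s idxA 0 = k + 1
  cnt : ∀ v : Fin n, s cntA v = ((unsat A C₀ x).filter fun u : Fin r =>
    s posA u ≤ k ∧ target A C₀ t x u = some v).card
  core : ∃ l : List (Fin n), l.Nodup ∧ (∀ v : Fin n, v ∈ l ↔ q ≤ s cntA v) ∧
    Core A C₀ B s x (stk ++ l)

theorem Voting.step {t B q : ℕ} {x : Fin n → ZMod 2} {stk : List (Fin n)} {k : ℕ} {s : Memory}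
    (h : Voting A C₀ t B q x stk k s) (hk : k < (unsat A C₀ x).card) :
    Voting A C₀ t B q x stk (k + 1) ((forVote C₀ t (bumpProg q)).eval s) := by
  obtain ⟨hidx, hcnt, l, hl, hmem, hcore⟩ := h
  have hfr : ∀ a : ArrayName, a ∉ [varA, cntA, stackA, topA] → a ≠ conA → a ≠ idxA →
      (forVote C₀ t (bumpProg q)).eval s a = s a := fun a h1 h2 h3 =>
    Prog.eval_frame s (forVote_writes C₀ (fun j => bumpProg_writes h1) h2 h3)
  obtain ⟨u, hu, hpos, s₁, s₂, g1, g2, g3, hcase⟩ := forVote_eval (t := t) A hcore.input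
    (P := bumpProg q) (fun j => bumpProg_writes (by simp)) hcore.list hidx hk
  set s' := (forVote C₀ t (bumpProg q)).eval s
  have hI : InputRep A s' x := hcore.input.congr
    (fun a ha => hfr a (by simp [isGraph_ne_work ha]) (isGraph_ne_work ha _)
      (isGraph_ne_work ha _)) (hfr _ (by simp) (by simp) (by simp))
  have hL : SetRep B s' (unsat A C₀ x) := hcore.list.congr (hfr _ (by simp) (by simp) (by simp))
    (hfr _ (by simp) (by simp) (by simp)) (hfr _ (by simp) (by simp) (by simp))
    (hfr _ (by simp) (by simp) (by simp))
  have hpos' : s' posA = s posA := hfr _ (by simp) (by simp) (by simp)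
  have hstep : ∀ v : Fin n, s' cntA v = s cntA v + if target A C₀ t x u = some v then 1 else 0 := by
    intro v
    rw [g2 _ (by simp)]
    rcases hcase with ⟨h1, rfl⟩ | ⟨j, h1, h2, rfl⟩
    · simp [h1, g1]
    · rw [bumpProg_cnt h2, g1 _ (by simp), h1]
      by_cases hv : v = A.right u j
      · subst hv; simp
      · rw [Function.update_of_ne (by simpa [Fin.ext_iff] using hv), if_neg]
        · simp
        · simpa using Ne.symm hv
  refine ⟨g3, fun v => ?_, ?_⟩
  · rw [hstep, hcnt, hpos', card_filter_pos_succ hcore.list hu hpos]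
  · rcases hcase with ⟨h1, rfl⟩ | ⟨j, h1, h2, rfl⟩
    · refine ⟨l, hl, fun v => ?_, hI, hL, hcore.stack.congr ?_ ?_⟩
      · rw [hstep, hmem]; simp [h1]
      · rw [g2 _ (by simp), g1 _ (by simp)]
      · rw [g2 _ (by simp), g1 _ (by simp)]
    · have hst := bumpProg_stack (q := q) h2 (hcore.stack.congr (s' := s₁) (g1 _ (by simp))
        (g1 _ (by simp)))
      rw [g1 cntA (by simp)] at hst
      have hst' := hst.congr (s' := s') (g2 _ (by simp)) (g2 _ (by simp))
      split_ifs at hst' with hq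
      · rw [List.append_assoc] at hst'
        refine ⟨l ++ [A.right u j], ?_, fun v => ?_, hI, hL, hst'⟩
        · rw [List.nodup_append_comm]
          refine List.nodup_cons.2 ⟨fun hm => ?_, hl⟩
          -- A variable already pushed had at least `q` votes before this one, whereas this vote is
          -- its `q`-th.
          have := (hmem _).1 hm
          omega
        · rw [hstep, h1, List.mem_append, hmem, List.mem_singleton]
          by_cases hv : v = A.right u j
          · subst hv; simp [hq]
          · simp [hv, Ne.symm hv]
      · refine ⟨l, hl, fun v => ?_, hI, hL, hst'⟩
        rw [hstep, h1, hmem]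
        by_cases hv : v = A.right u j
        · subst hv; simp; omega
        · simp [Ne.symm hv]

/-- The state of clearing the vote count after `k` votes. -/
structure Clearing (t B : ℕ) (x : Fin n → ZMod 2) (stk : List (Fin n)) (k : ℕ) (s : Memory) :
    Prop where
  idx : s idxA 0 = k + 1
  cnt : ∀ v : Fin n, s cntA v ≠ 0 →
    ∃ u ∈ unsat A C₀ x, k < s posA u ∧ target A C₀ t x u = some v
  core : Core A C₀ B s x stk

/-- Clear the vote count of the `j`-th neighbour of the current constraint. -/
def clearProg (j : ℕ) : Prog := .write cntA (.read (.right j) (.var conA)) (.const 0)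

/-- A second walk along the same list resets exactly the counters that can be nonzero; resetting all
`n` of them would be too slow for later rounds. The invariant charges each nonzero counter to a
voter that has not yet been visited. -/
theorem Clearing.step {t B : ℕ} {x : Fin n → ZMod 2} {stk : List (Fin n)} {k : ℕ} {s : Memory}
    (h : Clearing A C₀ t B x stk k s) (hk : k < (unsat A C₀ x).card) :
    Clearing A C₀ t B x stk (k + 1) ((forVote C₀ t clearProg).eval s) := by
  obtain ⟨hidx, hcnt, hcore⟩ := h
  have hfr : ∀ a : ArrayName, a ≠ cntA → a ≠ conA → a ≠ idxA →
      (forVote C₀ t clearProg).eval s a = s a := fun a h1 h2 h3 =>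
    Prog.eval_frame s (forVote_writes C₀ (fun j => h1) h2 h3)
  obtain ⟨u, hu, hpos, s₁, s₂, g1, g2, g3, hcase⟩ := forVote_eval (t := t) A hcore.input
    (P := clearProg) (fun j => by simp [clearProg, Prog.Writes]) hcore.list hidx hk
  set s' := (forVote C₀ t clearProg).eval s
  have hpos' : s' posA = s posA := hfr _ (by simp) (by simp) (by simp)
  refine ⟨g3, fun v hv => ?_, hcore.congr (fun a ha => hfr a (isGraph_ne_work ha _)
    (isGraph_ne_work ha _) (isGraph_ne_work ha _)) ?_⟩
  · have key : s cntA v ≠ 0 ∧ target A C₀ t x u ≠ some v := by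
      rw [g2 _ (by simp)] at hv
      rcases hcase with ⟨h1, rfl⟩ | ⟨j, h1, h2, rfl⟩
      · rw [g1 _ (by simp)] at hv
        exact ⟨hv, by simp [h1]⟩
      · simp only [clearProg, Prog.eval, Expr.value, h2, Memory.set_same] at hv
        by_cases hvj : v = A.right u j
        · subst hvj; simp at hv
        · rw [Function.update_of_ne (by simpa [Fin.ext_iff] using hvj), g1 _ (by simp)] at hv
          refine ⟨hv, ?_⟩
          rw [h1]
          simpa using Ne.symm hvj
    obtain ⟨w, hw, hw1, hw2⟩ := hcnt v key.1
    refine ⟨w, hw, ?_, hw2⟩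
    rw [hpos']
    have : s posA w ≠ k + 1 := by
      intro he
      rw [hcore.list.eq_of_pos_eq hw hu (he.trans hpos.symm)] at hw2
      exact key.2 hw2
    omega
  · intro a ha
    simp only [List.mem_cons, List.not_mem_nil, or_false] at ha
    rcases ha with rfl | rfl | rfl | rfl | rfl | rfl | rfl <;>
      exact hfr _ (by simp) (by simp) (by simp)

/-- Flip the next pending variable on the stack. -/
noncomputable def flipNext (c B : ℕ) : Prog :=
  .seq (.assign varA (.read stackA (.var baseA)))
    (.seq (flipProg C₀ c B) (.assign baseA (.succ (.var baseA))))

theorem flipNext_writes {B : ℕ} {a : ArrayName}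
    (h : a ∉ [listA, posA, lenA, scaledA, conA, varA, baseA, .word]) :
    ¬ (flipNext C₀ c B).Writes a := by
  simp only [List.mem_cons, List.not_mem_nil, or_false, not_or] at h
  rintro (h' | h' | h')
  · exact h.2.2.2.2.2.1 h'
  · exact flipProg_writes C₀ (by simp [h]) h'
  · exact h.2.2.2.2.2.2.1 h'

theorem flipNext_spec {B b : ℕ} {s : Memory} {x : Fin n → ZMod 2} {stk : List (Fin n)}
    (h : Core A C₀ B s x stk) (hb : s baseA 0 = b) (hlt : b < stk.length) :
    Core A C₀ B ((flipNext C₀ c B).eval s) (Function.update x stk[b] (x stk[b] + 1)) stk ∧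
      (flipNext C₀ c B).eval s baseA 0 = b + 1 := by
  set s₁ := (Prog.assign varA (.read stackA (.var baseA))).eval s with hs₁
  have hg : ∀ a : ArrayName, a ≠ varA → s₁ a = s a := fun a ha => Memory.set_of_ne _ ha _ _
  have hv : s₁ varA 0 = stk[b] := by
    simp [hs₁, Prog.eval, Expr.value, Memory.set_same, hb, h.stack.stack b hlt]
  have h₁ : Core A C₀ B s₁ x stk := by
    refine h.congr (fun a ha => hg a (isGraph_ne_work ha _)) fun a ha => hg a ?_
    rintro rfl
    simp at ha
  obtain ⟨k1, k2⟩ := flipProg_spec A C₀ h₁.input h₁.list hv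
  set s₂ := (flipProg C₀ c B).eval s₁ with hs₂
  have hf : ∀ a, a ∉ [listA, posA, lenA, scaledA, conA, .word] → s₂ a = s₁ a := fun a ha =>
    Prog.eval_frame s₁ (flipProg_writes C₀ ha)
  have h₂ : Core A C₀ B s₂ (Function.update x stk[b] (x stk[b] + 1)) stk :=
    ⟨k1, k2, h₁.stack.congr (hf _ (by simp)) (hf _ (by simp))⟩
  have hev : (flipNext C₀ c B).eval s = (Prog.assign baseA (.succ (.var baseA))).eval s₂ := rfl
  have hg' : ∀ a : ArrayName, a ≠ baseA → (flipNext C₀ c B).eval s a = s₂ a := fun a ha => by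
    rw [hev]; exact Memory.set_of_ne _ ha _ _
  refine ⟨h₂.congr (fun a ha => hg' a (isGraph_ne_work ha _)) fun a ha => hg' a ?_, ?_⟩
  · rintro rfl
    simp at ha
  · rw [hev]
    simp [Prog.eval, Expr.value, Memory.set_same, hf baseA (by simp), hg baseA (by simp), hb]

/-- The memory between two steps of the decoder. -/
structure Rep (B : ℕ) (s : Memory) (x : Fin n → ZMod 2) (stk : List (Fin n)) : Prop where
  core : Core A C₀ B s x stk
  cnt : ∀ v : Fin n, s cntA v = 0

variable {A C₀} in
theorem Rep.congr {B : ℕ} {s s' : Memory} {x : Fin n → ZMod 2} {stk : List (Fin n)}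
    (h : Rep A C₀ B s x stk) (h1 : ∀ a : ArrayName, a.IsGraph → s' a = s a)
    (h2 : ∀ a ∈ [.word, lenA, scaledA, posA, listA, topA, stackA, cntA], s' a = s a) :
    Rep A C₀ B s' x stk :=
  ⟨h.core.congr h1 fun a ha => h2 a (by simp at ha ⊢; tauto),
    fun v => by rw [h2 _ (by simp), h.cnt]⟩

/-- Flip all pending variables on the stack. -/
noncomputable def flipPending (c B : ℕ) : Prog :=
  .whileLe (.succ (.var baseA)) (.var topA) (flipNext C₀ c B)

/-- Only the entries above the base are flipped. With the base at `0` and `stk` empty, the same loop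
undoes a whole attempt. -/
theorem flipPending_term {B : ℕ} {s : Memory} {x : Fin n → ZMod 2} {stk l : List (Fin n)}
    (h : Rep A C₀ B s x (stk ++ l)) (hb : s baseA 0 = stk.length) :
    Term (flipPending C₀ c B) s ((l.length + 1) * (3 + 2 + 1 + (flipNext C₀ c B).bound))
      fun s' => Rep A C₀ B s' (shift x l) (stk ++ l) := by
  refine (Term.while_count (N := l.length) (T := (flipNext C₀ c B).bound)
    (fun k s' => Rep A C₀ B s' (shift x (l.take k)) (stk ++ l) ∧ s' baseA 0 = stk.length + k)
    (fun k hk s' hs' => ⟨?_, ?_⟩) (fun s' hs' => ?_) ⟨?_, hb⟩).mono le_rfl fun s' hs' => ?_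
  · simp only [Expr.value, hs'.2, hs'.1.core.stack.top, List.length_append]
    omega
  · refine Term.of_loopFree ⟨trivial, flipProg_loopFree C₀ B, trivial⟩ ?_
    obtain ⟨k1, k2⟩ := flipNext_spec A C₀ hs'.1.core hs'.2 (by simp; omega)
    refine ⟨⟨?_, fun v => ?_⟩, k2⟩
    · rw [List.take_succ_eq_append_getElem hk, shift_append_singleton]
      simpa using k1
    · rw [Prog.eval_frame s' (flipNext_writes C₀ (by simp)), hs'.1.cnt]
  · simp only [Expr.value, hs'.2, hs'.1.core.stack.top, List.length_append]
    omega
  · simpa [shift_nil] using h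
  · rw [List.take_length] at hs'
    exact hs'.1

/-- The program for one step of the decoder. -/
noncomputable def stepProg (t c B q : ℕ) : Prog :=
  .seq (.seq (.assign baseA (.var topA)) (.assign idxA (.const 1)))
    (.seq (forVotes C₀ t (bumpProg q))
      (.seq (.assign idxA (.const 1))
        (.seq (forVotes C₀ t clearProg) (flipPending C₀ c B))))

theorem stepProg_writes {t B q : ℕ} {a : ArrayName}
    (h : a ∉ [listA, posA, lenA, scaledA, conA, varA, baseA, idxA, cntA, stackA, topA, .word]) :
    ¬ (stepProg C₀ t c B q).Writes a := by
  simp only [List.mem_cons, List.not_mem_nil, or_false, not_or] at h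
  obtain ⟨h1, h2, h3, h4, h5, h6, h7, h8, h9, h10, h11, h12⟩ := h
  rintro ((h' | h') | h' | h' | h' | h')
  · exact h7 h'
  · exact h8 h'
  · exact forVote_writes C₀ (fun j => bumpProg_writes (q := q) (j := j) (by simp [*])) h5 h8 h'
  · exact h8 h'
  · exact forVote_writes C₀ (P := clearProg) (fun j => h9) h5 h8 h'
  · exact flipNext_writes C₀ (by simp [*]) h'

theorem forVotes_term {t B : ℕ} {P : ℕ → Prog} (hP : ∀ j, (P j).LoopFree) {x : Fin n → ZMod 2}
    {I : ℕ → Memory → Prop}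
    (hI : ∀ k s, I k s → s idxA 0 = k + 1 ∧ SetRep B s (unsat A C₀ x))
    (hstep : ∀ k < (unsat A C₀ x).card, ∀ s, I k s → I (k + 1) ((forVote C₀ t P).eval s))
    {s : Memory} (h : I 0 s) :
    Term (forVotes C₀ t P) s (((unsat A C₀ x).card + 1) * (2 + 2 + 1 + (forVote C₀ t P).bound))
      (I (unsat A C₀ x).card) := by
  refine Term.while_count I (fun k hk s hs => ⟨?_, ?_⟩) (fun s hs => ?_) h
  · obtain ⟨h1, h2⟩ := hI k s hs
    simp only [Expr.value, h1, h2.len]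
    omega
  · exact Term.of_loopFree (forVote_loopFree C₀ hP) (hstep k hk s hs)
  · obtain ⟨h1, h2⟩ := hI _ s hs
    simp only [Expr.value, h1, h2.len]
    omega

/-- One step of the decoder takes time proportional to the number of violated constraints. -/
theorem stepProg_term (t B : ℕ) {q : ℕ} (hq : 1 ≤ q) :
    ∃ K, ∀ {n r : ℕ} {G : SimpleGraph (Fin n ⊕ Fin r)} (A : AdjacencyLists G c d) (s : Memory)
      (x : Fin n → ZMod 2) (stk : List (Fin n)), Rep A C₀ B s x stk →
      Term (stepProg C₀ t c B q) s (K * ((unsat A C₀ x).card + 1)) fun s' =>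
        ∃ l : List (Fin n), Rep A C₀ B s' (flipStep A C₀ t q x) (stk ++ l) ∧
          shift x l = flipStep A C₀ t q x ∧ l.length ≤ (unsat A C₀ x).card := by
  refine ⟨100 + (forVote C₀ t (bumpProg q)).bound + (forVote C₀ t clearProg).bound +
    (flipNext C₀ c B).bound, fun {n r G} A s x stk h => ?_⟩
  set m := (unsat A C₀ x).card with hm
  set s₀ := (Prog.seq (.assign baseA (.var topA)) (.assign idxA (.const 1))).eval s with hs₀
  have hg : ∀ a : ArrayName, a ≠ baseA → a ≠ idxA → s₀ a = s a := fun a h1 h2 =>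
    Prog.eval_frame s (by simp [Prog.Writes, h1, h2])
  have hcore₀ : Core A C₀ B s₀ x stk := by
    refine h.core.congr (fun a ha => hg a (isGraph_ne_work ha _) (isGraph_ne_work ha _))
      fun a ha => hg a ?_ ?_ <;>
    · rintro rfl
      simp at ha
  have hV : Voting A C₀ t B q x stk 0 s₀ := by
    have hc0 : ∀ v : Fin n, s₀ cntA v = 0 := fun v => by rw [hg _ (by simp) (by simp), h.cnt]
    refine ⟨?_, fun v => ?_, [], List.nodup_nil, fun v => ?_, by simpa using hcore₀⟩
    · simp [hs₀, Prog.eval, Expr.value, Memory.set_same]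
    · rw [hc0, eq_comm, card_eq_zero, filter_eq_empty_iff]
      rintro u hu ⟨h1, -⟩
      have := (hcore₀.list.pos_mem u hu).1
      omega
    · rw [hc0]
      simp
      omega
  have hbase : s₀ baseA 0 = stk.length := by
    simp [hs₀, Prog.eval, Expr.value, Memory.set_same, Memory.set_of_ne, h.core.stack.top]
  refine Term.mono (T := (Prog.seq (.assign baseA (.var topA)) (.assign idxA (.const 1))).bound +
    ((m + 1) * (2 + 2 + 1 + (forVote C₀ t (bumpProg q)).bound) +
      ((Prog.assign idxA (.const 1)).bound +
        ((m + 1) * (2 + 2 + 1 + (forVote C₀ t clearProg).bound) +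
          (m + 1) * (3 + 2 + 1 + (flipNext C₀ c B).bound)))))
    (Term.seq_eval ⟨trivial, trivial⟩ ?_) ?_ fun _ h => h
  swap
  · simp only [Prog.bound, Expr.cost]
    ring_nf
    omega
  refine (forVotes_term A C₀ (B := B) (P := bumpProg q)
    (fun j => ⟨trivial, trivial, ⟨⟨trivial, trivial⟩, trivial⟩, trivial⟩)
    (I := Voting A C₀ t B q x stk) (fun k s hs => ⟨hs.idx, ?_⟩)
    (fun k hk s hs => hs.step A C₀ hk) hV).frame.seq ?_
  · obtain ⟨l, -, -, hc⟩ := hs.core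
    exact hc.list
  rintro s₁ ⟨⟨hidx, hcnt, l, hl, hmem, hcore⟩, hfr⟩
  have hcnt' : ∀ v : Fin n, s₁ cntA v = votes A C₀ t x v := by
    intro v
    rw [hcnt, votes]
    congr 1
    refine filter_congr fun u hu => ?_
    have := (hcore.list.pos_mem u hu).2.1
    simp [this]
  have hbase₁ : s₁ baseA 0 = stk.length := by
    rw [hfr, hbase]
    exact forVote_writes C₀ (fun j => bumpProg_writes (by simp)) (by simp) (by simp)
  have hl' : l.toFinset = univ.filter fun v => q ≤ votes A C₀ t x v := by
    ext v; simp [hmem, hcnt']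
  have hlen : l.length ≤ m := by
    rw [← List.toFinset_card_of_nodup hl, hl']
    exact card_flipped_le A hq x
  have hshift : shift x l = flipStep A C₀ t q x := by
    funext v
    simp only [shift, flipStep]
    split_ifs with hv
    · rw [← hcnt', ← hmem] at hv
      rw [List.count_eq_one_of_mem hl hv, Nat.cast_one]
    · rw [← hcnt', ← hmem] at hv
      rw [List.count_eq_zero_of_not_mem hv, Nat.cast_zero, add_zero]
  refine Term.seq_eval trivial ?_
  set s₂ := (Prog.assign idxA (.const 1)).eval s₁ with hs₂
  have hg₂ : ∀ a : ArrayName, a ≠ idxA → s₂ a = s₁ a := fun a ha => Memory.set_of_ne _ ha _ _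
  -- The counters are cleared before anything is flipped, while the word, the list and hence all
  -- votes are those of the counting pass.
  have hC : Clearing A C₀ t B x (stk ++ l) 0 s₂ := by
    refine ⟨by simp [hs₂, Prog.eval, Expr.value, Memory.set_same], fun v hv => ?_,
      hcore.congr (fun a ha => hg₂ a (isGraph_ne_work ha _)) fun a ha => hg₂ a ?_⟩
    · rw [hg₂ _ (by simp), hcnt', votes] at hv
      obtain ⟨u, hu⟩ := card_ne_zero.1 hv
      obtain ⟨hu1, hu2⟩ := mem_filter.1 hu
      refine ⟨u, hu1, ?_, hu2⟩
      rw [hg₂ _ (by simp)]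
      exact (hcore.list.pos_mem u hu1).1
    · rintro rfl
      simp at ha
  refine (forVotes_term A C₀ (B := B) (P := clearProg) (fun j => trivial)
    (I := Clearing A C₀ t B x (stk ++ l)) (fun k s hs => ⟨hs.idx, hs.core.list⟩)
    (fun k hk s hs => hs.step A C₀ hk) hC).frame.seq ?_
  rintro s₃ ⟨⟨-, hcnt₃, hcore₃⟩, hfr₃⟩
  have hbase₃ : s₃ baseA 0 = stk.length := by
    rw [hfr₃, hg₂ _ (by simp), hbase₁]
    exact forVote_writes C₀ (fun j => by simp [clearProg, Prog.Writes]) (by simp) (by simp)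
  have hzero : ∀ v : Fin n, s₃ cntA v = 0 := by
    intro v
    by_contra hv
    obtain ⟨u, hu, hu1, -⟩ := hcnt₃ v hv
    have := (hcore₃.list.pos_mem u hu).2.1
    omega
  refine (flipPending_term A C₀ ⟨hcore₃, hzero⟩ hbase₃).mono (Nat.mul_le_mul_right _ (by omega))
    fun s' hs' => ⟨l, ?_, hshift, hlen⟩
  rwa [hshift] at hs'

end Step

/-! ### Attempts, rounds, initialisation and the total running time. -/

section Decoder

variable {n r c d : ℕ} {G : SimpleGraph (Fin n ⊕ Fin r)} (A : AdjacencyLists G c d)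
  (C₀ : Submodule (ZMod 2) (Fin d → ZMod 2))

/-- Execute the steps with the thresholds in a list, and record whether too many constraints are
violated after some step. -/
noncomputable def stepsProg (t c B : ℕ) : List ℕ → Prog
  | [] => .skip
  | q :: σ => .seq (stepProg C₀ t c B q)
      (.seq (.ifLe (.var scaledA) (.var limitA) .skip (.assign badA (.const 1)))
        (stepsProg t c B σ))

theorem stepsProg_writes {t B : ℕ} {σ : List ℕ} {a : ArrayName}
    (h : a ∉ [listA, posA, lenA, scaledA, conA, varA, baseA, idxA, cntA, stackA, topA, .word,
      badA]) :
    ¬ (stepsProg C₀ t c B σ).Writes a := by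
  induction σ with
  | nil => exact fun h => h
  | cons q σ ih =>
    simp only [List.mem_cons, List.not_mem_nil, or_false, not_or] at h
    rintro (h' | (h' | h') | h')
    · exact stepProg_writes C₀ (by simp [h]) h'
    · exact h'
    · exact h.2.2.2.2.2.2.2.2.2.2.2.2 h'
    · exact ih h'

/-- The constant precedes the graph and the word in the quantifiers, here and below. It also bounds
the stack height, hence the cost of undoing the steps. -/
theorem stepsProg_term (t B : ℕ) {σ : List ℕ} (hσ : ∀ q ∈ σ, 1 ≤ q) :
    ∃ K, ∀ {n r : ℕ} {G : SimpleGraph (Fin n ⊕ Fin r)} (A : AdjacencyLists G c d) (s : Memory)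
      (x : Fin n → ZMod 2) (stk : List (Fin n)) (m : ℕ), Rep A C₀ B s x stk → s limitA 0 = m →
      Term (stepsProg C₀ t c B σ) s (K * ((unsat A C₀ x).card + 1)) fun s' =>
        ∃ l : List (Fin n), Rep A C₀ B s' (flipSteps A C₀ t σ x) (stk ++ l) ∧
          shift x l = flipSteps A C₀ t σ x ∧ l.length ≤ K * (unsat A C₀ x).card ∧
          (s' badA 0 = 0 ↔ s badA 0 = 0 ∧ StaysBelow A C₀ t B m σ x) := by
  induction σ with
  | nil =>
    refine ⟨1, fun {n r G} A s x stk m h hm => ?_⟩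
    refine (Term.of_loopFree (p := .skip) trivial ?_).mono (Nat.le_mul_of_pos_right _ (by omega))
      fun _ h => h
    exact ⟨[], by simpa [Prog.eval, flipSteps] using h, shift_nil x, by simp,
      by simp [StaysBelow, Prog.eval]⟩
  | cons q σ ih =>
    obtain ⟨K₁, h₁⟩ := stepProg_term (c := c) C₀ t B (hσ q (by simp))
    obtain ⟨K₂, h₂⟩ := ih fun q' hq' => hσ q' (by simp [hq'])
    -- The factor `1 + c` is the largest possible growth of the list in the first step.
    refine ⟨K₁ + 9 + K₂ * (1 + c) + 1, fun {n r G} A s x stk m h hm => ?_⟩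
    have hu := card_unsat_flipStep_le (C₀ := C₀) A (t := t) (hσ q (by simp)) x
    set u := (unsat A C₀ x).card
    set u' := (unsat A C₀ (flipStep A C₀ t q x)).card with hu'
    have hK := Nat.mul_le_mul_left K₂ hu
    refine Term.mono (T := K₁ * (u + 1) + (9 + K₂ * (u' + 1))) ((h₁ A s x stk h).frame.seq ?_) ?_
      fun _ h => h
    · rintro s₁ ⟨⟨l, hl, hsh, hlen⟩, hfr⟩
      have hm₁ : s₁ limitA 0 = m := by rw [hfr _ (stepProg_writes C₀ (by simp)), hm]
      have hb₁ : s₁ badA = s badA := hfr _ (stepProg_writes C₀ (by simp))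
      refine Term.seq_eval (p := .ifLe (.var scaledA) (.var limitA) .skip
        (.assign badA (.const 1))) ⟨trivial, trivial⟩ ?_
      set s₂ := (Prog.ifLe (.var scaledA) (.var limitA) .skip (.assign badA (.const 1))).eval s₁
        with hs₂
      have hfr₂ : ∀ a, a ≠ badA → s₂ a = s₁ a := fun a ha =>
        Prog.eval_frame s₁ (by simp [Prog.Writes, ha])
      have hb₂ : s₂ badA 0 = 0 ↔ s badA 0 = 0 ∧ B * u' ≤ m := by
        simp only [hs₂, Prog.eval, Expr.value, hl.core.list.scaled, hm₁, ← hu']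
        split_ifs with hc
        · simp [hb₁, hc]
        · simp [Memory.set_same, hc]
      have hR₂ : Rep A C₀ B s₂ (flipStep A C₀ t q x) (stk ++ l) := by
        refine hl.congr (fun a ha => hfr₂ a (isGraph_ne_work ha _)) fun a ha => hfr₂ a ?_
        rintro rfl
        simp at ha
      refine (h₂ A s₂ _ _ m hR₂ (by rw [hfr₂ _ (by simp), hm₁])).mono le_rfl ?_
      rintro s' ⟨l', hl', hsh', hlen', hb'⟩
      refine ⟨l ++ l', ?_, ?_, ?_, ?_⟩
      · rw [← List.append_assoc]; exact hl'
      · rw [← shift_shift, hsh, hsh']; rfl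
      · rw [List.length_append]
        nlinarith
      · rw [hb', hb₂, StaysBelow, and_assoc]
    · nlinarith

/-- Undo the flips of an attempt if it has failed. -/
noncomputable def settleProg (c B : ℕ) : Prog :=
  .ifLe (.const 1) (.var badA)
    (.seq (.assign baseA (.const 0)) (.seq (flipPending C₀ c B) (.assign topA (.const 0))))
    (.seq (.assign doneA (.const 1)) (.assign topA (.const 0)))

/-- Try a list of thresholds, unless an earlier attempt has succeeded. -/
noncomputable def attemptProg (t c B : ℕ) (σ : List ℕ) : Prog :=
  .ifLe (.const 1) (.var doneA) .skip
    (.seq (.assign badA (.const 0)) (.seq (stepsProg C₀ t c B σ)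
      (.seq (.ifLe (.var scaledA) (.var markA) .skip (.assign badA (.const 1)))
        (settleProg C₀ c B))))

theorem attemptProg_writes {t B : ℕ} {σ : List ℕ} {a : ArrayName}
    (h : a ∉ [listA, posA, lenA, scaledA, conA, varA, baseA, idxA, cntA, stackA, topA, .word,
      badA, doneA]) :
    ¬ (attemptProg C₀ t c B σ).Writes a := by
  simp only [List.mem_cons, List.not_mem_nil, or_false, not_or] at h
  obtain ⟨h1, h2, h3, h4, h5, h6, h7, h8, h9, h10, h11, h12, h13, h14⟩ := h
  rintro (h' | h' | h' | (h' | h') | (h' | h' | h') | h' | h')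
  · exact h'
  · exact h13 h'
  · exact stepsProg_writes C₀ (by simp [*]) h'
  · exact h'
  · exact h13 h'
  · exact h7 h'
  · exact flipNext_writes C₀ (by simp [*]) h'
  · exact h11 h'
  · exact h14 h'
  · exact h11 h'

/-- Characteristic two: flipping the same stack again undoes it, also when a variable occurs
repeatedly. -/
theorem shift_shift_self (x : Fin n → ZMod 2) (l : List (Fin n)) : shift (shift x l) l = x := by
  have h : ∀ a b : ZMod 2, a + b + b = a := by decide
  funext v
  simp [shift, h]

variable {A C₀} in
theorem Rep.clear_stack {B : ℕ} {s : Memory} {x : Fin n → ZMod 2} {stk : List (Fin n)}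
    (h : Rep A C₀ B s x stk) : Rep A C₀ B ((Prog.assign topA (.const 0)).eval s) x [] := by
  have hg : ∀ a : ArrayName, a ≠ topA → (Prog.assign topA (.const 0)).eval s a = s a :=
    fun a ha => Memory.set_of_ne _ ha _ _
  refine ⟨⟨h.core.input.congr (fun a ha => hg a (isGraph_ne_work ha _)) (hg _ (by simp)),
    h.core.list.congr (hg _ (by simp)) (hg _ (by simp)) (hg _ (by simp)) (hg _ (by simp)),
    ?_, ?_⟩, fun v => ?_⟩
  · simp [Prog.eval, Expr.value, Memory.set_same]
  · intro i hi
    simp at hi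
  · rw [hg _ (by simp), h.cnt]

theorem attemptProg_term (t B : ℕ) {σ : List ℕ} (hσ : ∀ q ∈ σ, 1 ≤ q) :
    ∃ K, ∀ {n r : ℕ} {G : SimpleGraph (Fin n ⊕ Fin r)} (A : AdjacencyLists G c d) (s : Memory)
      (x : Fin n → ZMod 2) (m : ℕ), Rep A C₀ B s x [] → s doneA 0 = 0 →
      s markA 0 = (unsat A C₀ x).card → s limitA 0 = m →
      Term (attemptProg C₀ t c B σ) s (K * ((unsat A C₀ x).card + 1)) fun s' =>
        (Accepts A C₀ t B m σ x ∧ s' doneA 0 = 1 ∧ Rep A C₀ B s' (flipSteps A C₀ t σ x) []) ∨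
        (¬ Accepts A C₀ t B m σ x ∧ s' doneA 0 = 0 ∧ Rep A C₀ B s' x []) := by
  obtain ⟨K, hK⟩ := stepsProg_term (c := c) C₀ t B hσ
  set F := 3 + 2 + 1 + (flipNext C₀ c B).bound with hF
  refine ⟨K + 30 + K * F + F, fun {n r G} A s x m h hdone hmark hm => ?_⟩
  set u := (unsat A C₀ x).card with hu
  refine Term.mono (T := 1 + 2 + 1 + (3 + (K * (u + 1) + (9 + (1 + 2 + 1 + (6 +
    ((K * u + 1) * F + 3))))))) (Term.ifLe (fun hc => ?_) fun _ => ?_) ?_ fun _ h => h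
  · simp [Expr.value, hdone] at hc
  swap
  · nlinarith
  refine Term.seq_eval (p := .assign badA (.const 0)) trivial ?_
  set s₁ := (Prog.assign badA (.const 0)).eval s with hs₁
  have hfr₁ : ∀ a, a ≠ badA → s₁ a = s a := fun a ha => Memory.set_of_ne _ ha _ _
  have hR₁ : Rep A C₀ B s₁ x [] := by
    refine h.congr (fun a ha => hfr₁ a (isGraph_ne_work ha _)) fun a ha => hfr₁ a ?_
    rintro rfl
    simp at ha
  have hb₁ : s₁ badA 0 = 0 := by simp [hs₁, Prog.eval, Expr.value, Memory.set_same]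
  refine (hK A s₁ x [] m hR₁ (by rw [hfr₁ _ (by simp), hm])).frame.seq ?_
  rintro s₂ ⟨⟨l, hR₂, hsh, hlen, hb₂⟩, hfr₂⟩
  rw [← hu] at hlen
  have hdone₂ : s₂ doneA 0 = 0 := by
    rw [hfr₂ _ (stepsProg_writes C₀ (by simp)), hfr₁ _ (by simp), hdone]
  have hmark₂ : s₂ markA 0 = u := by
    rw [hfr₂ _ (stepsProg_writes C₀ (by simp)), hfr₁ _ (by simp), hmark]
  refine Term.seq_eval (p := .ifLe (.var scaledA) (.var markA) .skip
    (.assign badA (.const 1))) ⟨trivial, trivial⟩ ?_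
  set s₃ := (Prog.ifLe (.var scaledA) (.var markA) .skip (.assign badA (.const 1))).eval s₂
    with hs₃
  have hfr₃ : ∀ a, a ≠ badA → s₃ a = s₂ a := fun a ha =>
    Prog.eval_frame s₂ (by simp [Prog.Writes, ha])
  have hb₃ : s₃ badA 0 = 0 ↔ Accepts A C₀ t B m σ x := by
    rw [Accepts, ← hu]
    simp only [hs₃, Prog.eval, Expr.value, hR₂.core.list.scaled, hmark₂]
    split_ifs with hc
    · simp [hb₂, hb₁, hc]
    · simp [Memory.set_same, hc]
  have hR₃ : Rep A C₀ B s₃ (flipSteps A C₀ t σ x) ([] ++ l) := by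
    refine hR₂.congr (fun a ha => hfr₃ a (isGraph_ne_work ha _)) fun a ha => hfr₃ a ?_
    rintro rfl
    simp at ha
  have hdone₃ : s₃ doneA 0 = 0 := by rw [hfr₃ _ (by simp), hdone₂]
  refine Term.ifLe (fun hc => ?_) fun hc => ?_
  · simp only [Expr.value] at hc
    have hacc : ¬ Accepts A C₀ t B m σ x := by
      rw [← hb₃]
      omega
    refine Term.mono (T := 3 + ((l.length + 1) * F + 3)) (Term.seq_eval
      (p := .assign baseA (.const 0)) trivial ?_) ?_ fun _ h => h
    swap
    · have := Nat.mul_le_mul_right F (Nat.add_le_add_right hlen 1)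
      omega
    set s₄ := (Prog.assign baseA (.const 0)).eval s₃ with hs₄
    have hfr₄ : ∀ a, a ≠ baseA → s₄ a = s₃ a := fun a ha => Memory.set_of_ne _ ha _ _
    have hR₄ : Rep A C₀ B s₄ (flipSteps A C₀ t σ x) ([] ++ l) := by
      refine hR₃.congr (fun a ha => hfr₄ a (isGraph_ne_work ha _)) fun a ha => hfr₄ a ?_
      rintro rfl
      simp at ha
    refine (flipPending_term A C₀ hR₄
      (by simp [hs₄, Prog.eval, Expr.value, Memory.set_same])).frame.seq ?_
    rintro s₅ ⟨hR₅, hfr₅⟩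
    rw [← hsh, shift_shift_self] at hR₅
    refine Term.of_loopFree (p := .assign topA (.const 0)) trivial (.inr ⟨hacc, ?_, hR₅.clear_stack⟩)
    rw [Prog.eval_frame s₅ (by simp [Prog.Writes]), hfr₅ _ (flipNext_writes C₀ (by simp)),
      hfr₄ _ (by simp), hdone₃]
  · simp only [Expr.value] at hc
    have hacc : Accepts A C₀ t B m σ x := by
      rw [← hb₃]
      omega
    refine (Term.of_loopFree (p := .seq (.assign doneA (.const 1)) (.assign topA (.const 0)))
      ⟨trivial, trivial⟩ (.inl ⟨hacc, ?_, ?_⟩)).mono ?_ fun _ h => h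
    · simp only [Prog.bound, Expr.cost]
      omega
    · simp [Prog.eval, Expr.value, Memory.set_same, Memory.set_of_ne]
    · refine Rep.clear_stack (stk := [] ++ l) (hR₃.congr
        (fun a ha => Memory.set_of_ne _ (isGraph_ne_work ha _) _ _)
        fun a ha => Memory.set_of_ne _ ?_ _ _)
      rintro rfl
      simp at ha

/-- Try lists of thresholds until one succeeds. -/
noncomputable def attemptsProg (t c B : ℕ) : List (List ℕ) → Prog
  | [] => .skip
  | σ :: L => .seq (attemptProg C₀ t c B σ) (attemptsProg t c B L)

theorem attemptsProg_writes {t B : ℕ} {L : List (List ℕ)} {a : ArrayName}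
    (h : a ∉ [listA, posA, lenA, scaledA, conA, varA, baseA, idxA, cntA, stackA, topA, .word,
      badA, doneA]) :
    ¬ (attemptsProg C₀ t c B L).Writes a := by
  induction L with
  | nil => exact fun h => h
  | cons σ L ih =>
    rintro (h' | h')
    · exact attemptProg_writes C₀ h h'
    · exact ih h'

theorem attemptsProg_term_of_done (t B : ℕ) (L : List (List ℕ)) {s : Memory} (h : s doneA 0 = 1) :
    Term (attemptsProg C₀ t c B L) s (5 * L.length + 1) fun s' => s' = s := by
  induction L with
  | nil => exact Term.of_loopFree (p := .skip) trivial rfl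
  | cons σ L ih =>
    refine Term.mono (T := 5 + (5 * L.length + 1))
      (Term.seq (R := fun s' => s' = s) ?_ ?_) ?_ fun _ h => h
    · refine (Term.ifLe (T := 1)
        (fun _ => Term.of_loopFree (p := .skip) (Q := fun s' => s' = s) trivial rfl)
        fun hc => ?_).mono le_rfl fun _ h => h
      simp [Expr.value, h] at hc
    · rintro s' rfl
      exact ih
    · rw [List.length_cons]
      omega

theorem attemptsProg_term (t B : ℕ) {L : List (List ℕ)} (hL : ∀ σ ∈ L, ∀ q ∈ σ, 1 ≤ q) :
    ∃ K, ∀ {n r : ℕ} {G : SimpleGraph (Fin n ⊕ Fin r)} (A : AdjacencyLists G c d) (s : Memory)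
      (x : Fin n → ZMod 2) (m : ℕ), Rep A C₀ B s x [] → s doneA 0 = 0 →
      s markA 0 = (unsat A C₀ x).card → s limitA 0 = m →
      Term (attemptsProg C₀ t c B L) s (K * ((unsat A C₀ x).card + 1)) fun s' =>
        (∃ σ ∈ L, Accepts A C₀ t B m σ x ∧ s' doneA 0 = 1 ∧
          Rep A C₀ B s' (flipSteps A C₀ t σ x) []) ∨
        ((∀ σ ∈ L, ¬ Accepts A C₀ t B m σ x) ∧ s' doneA 0 = 0 ∧ Rep A C₀ B s' x []) := by
  induction L with
  | nil =>
    refine ⟨1, fun {n r G} A s x m h hdone _ _ => ?_⟩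
    refine (Term.of_loopFree (p := .skip) trivial (.inr ⟨by simp, hdone, h⟩)).mono
      (Nat.le_mul_of_pos_right _ (by omega)) fun _ h => h
  | cons σ L ih =>
    obtain ⟨K₁, h₁⟩ := attemptProg_term (c := c) C₀ t B (hL σ (by simp))
    obtain ⟨K₂, h₂⟩ := ih fun σ' hσ' => hL σ' (by simp [hσ'])
    refine ⟨K₁ + (K₂ + (5 * L.length + 1)), fun {n r G} A s x m h hdone hmark hm => ?_⟩
    rw [add_mul]
    refine (h₁ A s x m h hdone hmark hm).frame.seq ?_
    rintro s₁ ⟨⟨hacc, hd₁, hR₁⟩ | ⟨hacc, hd₁, hR₁⟩, hfr⟩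
    · refine (attemptsProg_term_of_done C₀ t B L hd₁).mono ?_ ?_
      · nlinarith
      · rintro s' rfl
        exact .inl ⟨σ, by simp, hacc, hd₁, hR₁⟩
    · refine (h₂ A s₁ x m hR₁ hd₁ ?_ ?_).mono (Nat.mul_le_mul_right _ (by omega)) ?_
      · rw [hfr _ (attemptProg_writes C₀ (by simp)), hmark]
      · rw [hfr _ (attemptProg_writes C₀ (by simp)), hm]
      · rintro s' (⟨τ, hτ, h'⟩ | ⟨h', h''⟩)
        · exact .inl ⟨τ, by simp [hτ], h'⟩
        · refine .inr ⟨fun τ hτ => ?_, h''⟩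
          rcases List.mem_cons.1 hτ with rfl | hτ
          · exact hacc
          · exact h' τ hτ

/-- One round of the decoder. -/
noncomputable def roundProg (t c B : ℕ) (L : List (List ℕ)) : Prog :=
  .seq (.seq (.assign markA (.var lenA)) (.assign doneA (.const 0)))
    (.seq (attemptsProg C₀ t c B L)
      (.ifLe (.const 1) (.var doneA) .skip (.assign goA (.const 0))))

theorem roundProg_term (t B : ℕ) {L : List (List ℕ)} (hL : ∀ σ ∈ L, ∀ q ∈ σ, 1 ≤ q) :
    ∃ K, ∀ {n r : ℕ} {G : SimpleGraph (Fin n ⊕ Fin r)} (A : AdjacencyLists G c d) (s : Memory)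
      (x : Fin n → ZMod 2) (m : ℕ), Rep A C₀ B s x [] → s goA 0 = 1 → s limitA 0 = m →
      Term (roundProg C₀ t c B L) s (K * ((unsat A C₀ x).card + 1)) fun s' =>
        (∃ σ ∈ L, Accepts A C₀ t B m σ x ∧ s' goA 0 = 1 ∧ s' limitA 0 = m ∧
          Rep A C₀ B s' (flipSteps A C₀ t σ x) []) ∨
        ((∀ σ ∈ L, ¬ Accepts A C₀ t B m σ x) ∧ s' goA 0 = 0) := by
  obtain ⟨K, hK⟩ := attemptsProg_term (c := c) C₀ t B hL
  refine ⟨K + 20, fun {n r G} A s x m h hgo hm => ?_⟩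
  set u := (unsat A C₀ x).card with hu
  refine Term.mono (T := 7 + (K * (u + 1) + 8)) (Term.seq_eval
    (p := .seq (.assign markA (.var lenA)) (.assign doneA (.const 0))) ⟨trivial, trivial⟩ ?_)
    (by nlinarith) fun _ h => h
  set s₁ := (Prog.seq (.assign markA (.var lenA)) (.assign doneA (.const 0))).eval s with hs₁
  have hfr₁ : ∀ a, a ≠ markA → a ≠ doneA → s₁ a = s a := fun a h1 h2 =>
    Prog.eval_frame s (by simp [Prog.Writes, h1, h2])
  have hR₁ : Rep A C₀ B s₁ x [] := by
    refine h.congr (fun a ha => hfr₁ a (isGraph_ne_work ha _) (isGraph_ne_work ha _))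
      fun a ha => hfr₁ a ?_ ?_ <;>
    · rintro rfl
      simp at ha
  refine (hK A s₁ x m hR₁ (by simp [hs₁, Prog.eval, Expr.value, Memory.set_same])
    (by simp [hs₁, Prog.eval, Expr.value, Memory.set_same, Memory.set_of_ne, h.core.list.len])
    (by rw [hfr₁ _ (by simp) (by simp), hm])).frame.seq ?_
  rintro s₂ ⟨hcase, hfr₂⟩
  have hgo₂ : s₂ goA 0 = 1 := by
    rw [hfr₂ _ (attemptsProg_writes C₀ (by simp)), hfr₁ _ (by simp) (by simp), hgo]
  have hm₂ : s₂ limitA 0 = m := by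
    rw [hfr₂ _ (attemptsProg_writes C₀ (by simp)), hfr₁ _ (by simp) (by simp), hm]
  refine Term.of_loopFree (p := .ifLe (.const 1) (.var doneA) .skip (.assign goA (.const 0)))
    ⟨trivial, trivial⟩ ?_
  rcases hcase with ⟨σ, hσ, hacc, hd, hR⟩ | ⟨hacc, hd, -⟩
  · left
    have he : (Prog.ifLe (.const 1) (.var doneA) .skip (.assign goA (.const 0))).eval s₂ = s₂ := by
      simp [Prog.eval, Expr.value, hd]
    rw [he]
    exact ⟨σ, hσ, hacc, hgo₂, hm₂, hR⟩
  · right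
    exact ⟨hacc, by simp [Prog.eval, Expr.value, hd, Memory.set_same]⟩

/-- Rounds until no constraint is violated or no attempt succeeds. -/
noncomputable def mainProg (t c B s : ℕ) : Prog :=
  .whileLe (.const 1) (.var goA)
    (.ifLe (.const 1) (.var lenA) (roundProg C₀ t c B (thresholdLists c s))
      (.assign goA (.const 0)))

/-- Halting in the stated time does not need a nearby codeword; only the claim about the output
does. The induction is on the number of violated constraints. -/
theorem mainProg_term {d₀ t B a s : ℕ} {α δ γ : ℝ} (hT : IsTuned c d₀ t B a s α δ γ)
    (hmin : ∀ z ∈ C₀, ∀ z' ∈ C₀, z ≠ z' → d₀ ≤ hammingDist z z') :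
    ∃ K, ∀ {n r : ℕ} {G : SimpleGraph (Fin n ⊕ Fin r)}, IsBipartiteExpander G c d α δ →
      ∀ (A : AdjacencyLists G c d) (st : Memory) (x : Fin n → ZMod 2), Rep A C₀ B st x [] →
      st goA 0 = 1 → st limitA 0 = a * n →
      Term (mainProg C₀ t c B s) st (K * ((unsat A C₀ x).card + 1)) fun s' =>
        ∀ y ∈ tannerCode A C₀, ((errors x y).card : ℝ) ≤ γ * n →
          ∀ v : Fin n, s' .word v = (y v).val := by
  have hL : ∀ σ ∈ thresholdLists c s, ∀ q ∈ σ, 1 ≤ q := fun σ hσ q hq =>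
    (mem_Icc.1 ((mem_thresholdLists.1 hσ).2 q hq)).1
  obtain ⟨K, hK⟩ := roundProg_term (c := c) C₀ t B hL
  have hB : 2 ≤ B := by
    have := hT.t_pos
    have := hT.t_le
    have := hT.le_B
    omega
  refine ⟨4 * K + 40, fun {n r G} hG A st x h hgo hm => ?_⟩
  -- A bound that survives the induction: a round costs at most `K(u + 1) + 8 ≤ (2K + 10)u` for `u ≥
  -- 1`, half of the allowance `(4K + 20)u`, and the remaining half covers `u / 2` violated
  -- constraints. The final `20` pays for leaving the loop.
  refine Term.mono (T := (4 * K + 20) * (unsat A C₀ x).card + 20) ?_ (by nlinarith) fun _ h => h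
  induction hu : (unsat A C₀ x).card using Nat.strong_induction_on generalizing st x with
  | _ u ih =>
    have hguard : Expr.value st (.const 1) ≤ Expr.value st (.var goA) := by
      simp [Expr.value, hgo]
    by_cases hu0 : u = 0
    · subst hu0
      refine Term.mono (T := 4 + 7 + 4) (Term.while_step (e := .const 1) (f := .var goA)
        (T := 7) (R := fun s' => s' goA 0 = 0 ∧ s' .word = st .word) hguard ?_ ?_) (by omega)
        fun _ h => h
      · refine Term.ifLe (T := 3) (e := .const 1) (f := .var lenA) (fun hc => ?_) fun _ => ?_
        · simp [Expr.value, h.core.list.len, hu] at hc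
        · refine Term.of_loopFree (p := .assign goA (.const 0)) trivial ⟨?_, ?_⟩
          · simp [Prog.eval, Expr.value, Memory.set_same]
          · exact Memory.set_of_ne _ (by simp) _ _
      · rintro s' ⟨h1, h2⟩
        refine Term.while_done (by simp [Expr.value, h1]) le_rfl fun y hy hxy v => ?_
        rw [h2, h.core.input.word, eq_of_unsat_eq_empty A hT hG hmin hy hxy (card_eq_zero.1 hu)]
    · refine Term.mono (T := 4 + (4 + K * (u + 1)) + ((4 * K + 20) * (u / 2) + 20))
        (Term.while_step (e := .const 1) (f := .var goA) hguard
          (Term.ifLe (e := .const 1) (f := .var lenA) (fun _ => hu ▸ hK A st x (a * n) h hgo hm)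
            fun hc => ?_) ?_) ?_ fun _ h => h
      · simp [Expr.value, h.core.list.len, hu] at hc
        omega
      · rintro s' (⟨σ, hσ, hacc, hgo', hm', hR'⟩ | ⟨hacc, hgo'⟩)
        · have h1 : 2 * (unsat A C₀ (flipSteps A C₀ t σ x)).card ≤ u :=
            (Nat.mul_le_mul_right _ hB).trans (hu ▸ hacc.2)
          refine (ih _ (by omega) s' _ hR' hgo' hm' rfl).mono ?_ fun s'' hs'' y hy hxy => ?_
          · exact Nat.add_le_add_right (Nat.mul_le_mul_left _ (by omega)) _
          · exact hs'' y hy (card_errors_le_of_accepts A hT hG hmin hy (hL σ hσ) hxy hacc)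
        -- All lists were rejected, which is impossible within the decoding radius; so the claim
        -- about the output is vacuous here.
        · refine Term.while_done (by simp [Expr.value, hgo']) (by simp only [Expr.cost]; omega)
            fun y hy hxy => ?_
          obtain ⟨σ, hσ, h1⟩ := exists_accepts A hT hG hmin hy hxy
          exact absurd h1 (hacc σ hσ)
      · have h1 : 2 * (u / 2) ≤ u := Nat.mul_div_le u 2
        have h2 : 1 ≤ u := by omega
        nlinarith [Nat.mul_le_mul_left K h1, Nat.mul_le_mul_left K h2]

/-- Compute the limit and the list of violated constraints. -/
noncomputable def initProg (a B : ℕ) : Prog :=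
  .seq (.assign goA (.const 1))
    (.seq
      (.whileLe (.succ (.var idxA)) (.read .size (.const 0))
        (.seq (.assign limitA ((Expr.var limitA).plus a)) (.assign idxA (.succ (.var idxA)))))
      (.whileLe (.succ (.var conA)) (.read .size (.const 1))
        (.seq (updateProg C₀ B) (.assign conA (.succ (.var conA))))))

theorem inputRep_inputMemory (x : Fin n → ZMod 2) : InputRep A (inputMemory A x) x := by
  constructor <;> simp [inputMemory]

theorem initProg_term (a B : ℕ) :
    ∃ K, ∀ {n r : ℕ} {G : SimpleGraph (Fin n ⊕ Fin r)} (A : AdjacencyLists G c d)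
      (x : Fin n → ZMod 2),
      Term (initProg C₀ a B) (inputMemory A x) (K * (n + r + 1)) fun s =>
        Rep A C₀ B s x [] ∧ s goA 0 = 1 ∧ s limitA 0 = a * n := by
  set p₁ : Prog :=
    .seq (.assign limitA ((Expr.var limitA).plus a)) (.assign idxA (.succ (.var idxA))) with hp₁
  set p₂ : Prog := .seq (updateProg C₀ B) (.assign conA (.succ (.var conA))) with hp₂
  refine ⟨20 + p₁.bound + p₂.bound, fun {n r G} A x => ?_⟩
  refine Term.mono (T := 3 + ((n + 1) * (6 + p₁.bound) + (r + 1) * (6 + p₂.bound)))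
    (Term.seq_eval (p := .assign goA (.const 1)) trivial ?_) (by nlinarith) fun _ h => h
  set s₁ := (Prog.assign goA (.const 1)).eval (inputMemory A x) with hs₁
  have hfr₁ : ∀ a, a ≠ goA → s₁ a = inputMemory A x a := fun a ha => Memory.set_of_ne _ ha _ _
  have hI₁ : InputRep A s₁ x := (inputRep_inputMemory A x).congr
    (fun a ha => hfr₁ a (isGraph_ne_work ha _)) (hfr₁ _ (by simp))
  have hgo₁ : s₁ goA 0 = 1 := by simp [hs₁, Prog.eval, Expr.value, Memory.set_same]
  have hzero₁ : ∀ k i, ArrayName.work k ≠ goA → s₁ (.work k) i = 0 := fun k i hk => by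
    rw [hfr₁ _ hk]; rfl
  -- The machine cannot multiply, so `a * n` is obtained by adding `a` once for each variable.
  refine (Term.while_count (N := n) (T := p₁.bound) (p := p₁) (e := .succ (.var idxA))
    (f := .read .size (.const 0))
    (fun k s => s idxA 0 = k ∧ s limitA 0 = a * k ∧ ∀ b, b ≠ idxA → b ≠ limitA → s b = s₁ b)
    (fun k hk s hs => ⟨?_, ?_⟩) (fun s hs => ?_)
    ⟨hzero₁ _ _ (by simp), hzero₁ _ _ (by simp), fun _ _ _ => rfl⟩).seq ?_
  · obtain ⟨h1, h2, h3⟩ := hs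
    simp only [Expr.value, h1, h3 .size (by simp) (by simp), hI₁.size_zero]
    omega
  · obtain ⟨h1, h2, h3⟩ := hs
    refine Term.of_loopFree ⟨trivial, trivial⟩ ⟨?_, ?_, fun b hb hb' => ?_⟩
    · simp [hp₁, Prog.eval, Expr.value, Memory.set_same, Memory.set_of_ne, h1]
    · simp [hp₁, Prog.eval, Expr.value, Expr.value_plus, Memory.set_same, Memory.set_of_ne, h2]
      ring
    · rw [← h3 b hb hb']
      exact Prog.eval_frame s (by simp [hp₁, Prog.Writes, hb, hb'])
  · obtain ⟨h1, h2, h3⟩ := hs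
    simp only [Expr.value, h1, h3 .size (by simp) (by simp), hI₁.size_zero]
    omega
  rintro s₂ ⟨-, hlim, hfr₂⟩
  have hI₂ : InputRep A s₂ x := hI₁.congr
    (fun a ha => hfr₂ a (isGraph_ne_work ha _) (isGraph_ne_work ha _))
    (hfr₂ _ (by simp) (by simp))
  have hzero₂ : ∀ k i, ArrayName.work k ∉ [goA, idxA, limitA] → s₂ (.work k) i = 0 := by
    intro k i hk
    simp only [List.mem_cons, List.not_mem_nil, or_false, not_or] at hk
    rw [hfr₂ _ hk.2.1 hk.2.2, hzero₁ k i hk.1]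
  have hw₂ : ∀ b, b ∉ [listA, posA, lenA, scaledA, conA] → ¬ p₂.Writes b := by
    rintro b hb (h' | h')
    · refine updateProg_writes C₀ ?_ h'
      simp only [List.mem_cons, List.not_mem_nil, or_false, not_or] at hb ⊢
      tauto
    · simp only [List.mem_cons, List.not_mem_nil, or_false, not_or] at hb
      exact hb.2.2.2.2 h'
  refine (Term.while_count (N := r) (T := p₂.bound) (p := p₂) (e := .succ (.var conA))
    (f := .read .size (.const 1))
    (fun k s => s conA 0 = k ∧ InputRep A s x ∧
      (∀ b, b ∉ [listA, posA, lenA, scaledA, conA] → s b = s₂ b) ∧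
      ∃ S : Finset (Fin r), SetRep B s S ∧ ∀ u, u ∈ S ↔ u < k ∧ u ∈ unsat A C₀ x)
    (fun k hk s hs => ⟨?_, ?_⟩) (fun s hs => ?_)
    ⟨hzero₂ _ _ (by simp), hI₂, fun _ _ => rfl, ∅, ?_, by simp⟩).mono le_rfl ?_
  · obtain ⟨h1, h2, -⟩ := hs
    simp only [Expr.value, h1, h2.size_one]
    omega
  · obtain ⟨h1, h2, h3, S, hS, hmem⟩ := hs
    obtain ⟨S', hS', hmem'⟩ := updateProg_spec A C₀ h2 hS (u := ⟨k, hk⟩) h1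
    have hfr : ∀ b, b ≠ conA → p₂.eval s b = (updateProg C₀ B).eval s b := fun b hb =>
      Memory.set_of_ne _ hb _ _
    refine Term.of_loopFree ⟨updateProg_loopFree C₀ B, trivial⟩ ⟨?_, ?_, fun b hb => ?_, S', ?_, ?_⟩
    · have : (updateProg C₀ B).eval s conA 0 = k := by
        rw [Prog.eval_frame s (updateProg_writes C₀ (by simp)), h1]
      simp [hp₂, Prog.eval, Expr.value, Memory.set_same, this]
    · exact h2.congr (fun a ha => Prog.eval_frame s (hw₂ a (by simp [isGraph_ne_work ha])))
        (Prog.eval_frame s (hw₂ _ (by simp)))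
    · rw [Prog.eval_frame s (hw₂ b hb), h3 b hb]
    · exact hS'.congr (hfr _ (by simp)) (hfr _ (by simp)) (hfr _ (by simp)) (hfr _ (by simp))
    · intro u
      rw [hmem', hmem]
      split_ifs with hu
      · subst hu; simp
      · have : (u : ℕ) ≠ k := fun h => hu (Fin.ext h)
        rw [Nat.lt_succ_iff_lt_or_eq, or_iff_left this]
  · obtain ⟨h1, h2, -⟩ := hs
    simp only [Expr.value, h1, h2.size_one]
    omega
  -- Blank memory represents the empty set, because positions in the list start at `1` and `0` means
  -- absent.
  · constructor
    · simpa using hzero₂ 4 0 (by simp)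
    · simpa using hzero₂ 5 0 (by simp)
    · simp
    · exact fun u _ => hzero₂ 1 u (by simp)
    · intro i hi hi'
      simp at hi'
      omega
  · rintro s ⟨-, hI, hfr, S, hS, hmem⟩
    have hSU : S = unsat A C₀ x := by
      ext u
      simp [hmem]
    refine ⟨⟨⟨hI, hSU ▸ hS, ?_, by simp⟩, fun v => ?_⟩, ?_, ?_⟩
    · rw [hfr _ (by simp), hzero₂ 6 0 (by simp)]
      rfl
    · rw [hfr _ (by simp), hzero₂ 2 v (by simp)]
    · rw [hfr _ (by simp), hfr₂ _ (by simp) (by simp), hgo₁]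
    · rw [hfr _ (by simp), hlim]

end Decoder

end ExpanderCode

open ExpanderCode in
/-- The program `p` and the constant `K` depend only on `c, d, α, δ` and `C₀`, not on `n` or `G`.
On every input word the program halts after at most `K n` steps; if the input is within distance
`γ n` of a codeword `y` of the Tanner code, then the output is `y`. -/
theorem theorem1p3 (c d : ℕ) (hc : 0 < c) (hd : 0 < d) (α δ : ℝ)
    (hα : 0 < α) (hα1 : α ≤ 1) (hδ : 0 < δ) (hδ1 : δ ≤ 1)
    (C₀ : Submodule (ZMod 2) (Fin d → ZMod 2)) (k₀ d₀ : ℕ) (hk₀ : 0 < k₀)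
    (hC₀ : IsLinearCode C₀ k₀ d₀) (hδd₀ : 3 < δ * d₀) :
    ∃ (p : Prog) (K : ℕ), ∀ (n r : ℕ), 0 < n →
      ∀ (G : SimpleGraph (Fin n ⊕ Fin r)), IsBipartiteExpander G c d α δ →
      ∀ (A : AdjacencyLists G c d) (x : Fin n → ZMod 2),
        ∃ (t : ℕ) (s : Memory), Runs p (inputMemory A x) t s ∧ t ≤ K * n ∧
          ∀ y ∈ tannerCode A C₀,
            (hammingDist x y : ℝ) ≤ 2 * α / (d₀ * (1 + 0.5 * c * δ)) * n →
            ∀ v : Fin n, s ArrayName.word v = (y v).val := by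
  obtain ⟨t, B, a, s, hT⟩ := exists_isTuned hc hα hδ hδ1 hδd₀
  have hmin : ∀ z ∈ C₀, ∀ z' ∈ C₀, z ≠ z' → d₀ ≤ hammingDist z z' := fun z hz z' hz' hne =>
    hC₀.minDist.2 ⟨z, hz, z', hz', hne, rfl⟩
  obtain ⟨K₁, h₁⟩ := initProg_term (c := c) C₀ a B
  obtain ⟨K₂, h₂⟩ := mainProg_term C₀ hT hmin
  refine ⟨.seq (initProg C₀ a B) (mainProg C₀ t c B s), K₁ * (2 + c) + K₂ * (1 + c),
    fun n r hn G hG A x => ?_⟩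
  -- Counting edges gives `r * d = c * n`, and `d ≥ 1`.
  have hr : r ≤ c * n := card_constraints A ▸ Nat.le_mul_of_pos_right r hd
  have hu : (unsat A C₀ x).card ≤ r := (Finset.card_le_univ _).trans_eq (Fintype.card_fin r)
  have key : Term (.seq (initProg C₀ a B) (mainProg C₀ t c B s)) (inputMemory A x)
      (K₁ * (n + r + 1) + K₂ * ((unsat A C₀ x).card + 1)) fun s' =>
        ∀ y ∈ tannerCode A C₀, ((errors x y).card : ℝ) ≤
          2 * α / (d₀ * (1 + 0.5 * c * δ)) * n → ∀ v : Fin n, s' .word v = (y v).val :=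
    (h₁ A x).seq fun s' hs' => h₂ hG A s' x hs'.1 hs'.2.1 hs'.2.2
  refine key.mono ?_ fun _ h => h
  -- Since `n ≥ 1`, the additive constants are absorbed: `n + r + 1 ≤ (2 + c)n` and `|U| + 1 ≤ (1 +
  -- c)n`.
  calc K₁ * (n + r + 1) + K₂ * ((unsat A C₀ x).card + 1)
      ≤ K₁ * ((2 + c) * n) + K₂ * ((1 + c) * n) := by
        gcongr
        · nlinarith
        · nlinarith
    _ = (K₁ * (2 + c) + K₂ * (1 + c)) * n := by ring
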